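/- An ample groupoid is a topological groupoid $\mathcal G$, not necessarily Hausdorff, whose unit space $\mathcal G^0$ is locally compact, Hausdorff and totally disconnected and whose source map $s\colon \mathcal G\to\mathcal G^0$ is a local homeomorphism; $r$ denotes its range map, and $ab$ is defined when $s(a)=r(b)$. Its groupoid ring $\mathbb Z\mathcal G$ is the group of functions $\mathcal G\to\mathbb Z$ generated by the characteristic functions of the compact (that is, quasi-compact and Hausdorff) open subsets of $\mathcal G$, with the convolution product $(f*h)(g)=\sum_{r(a)=r(g)}f(a)h(a^{-1}g)$. If $\mathcal G^0$ is compact, this ring is unital with identity $1_{\mathcal G^0}$. The group $\mathbb Z\mathcal G^0$ of locally constant, compactly supported functions $\mathcal G^0\to\mathbb Z$ is a right $\mathbb Z\mathcal G$-module via $(hf)(x)=\sum_{s(g)=x}h(r(g))f(g)$ and a left $\mathbb Z\mathcal G$-module via $(fh)(x)=\sum_{r(g)=x}f(g)h(s(g))$, for $f\in\mathbb Z\mathcal G$ and $h\in\mathbb Z\mathcal G^0$. For a left $\mathbb Z\mathcal G$-module $M$ one puts $H_n(\mathcal G,M)=\mathrm{Tor}_n^{\mathbb Z\mathcal G}(\mathbb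 Z\mathcal G^0,M)$ and $H_n(\mathcal G)=H_n(\mathcal G,\mathbb Z\mathcal G^0)$. **Theorem.** Let $\mathcal G$ be an ample groupoid with compact unit space, and let $Y\subseteq\mathcal G^0$ be a compact open subset that is full, i.e., that meets every orbit: $r(s^{-1}(Y))=\mathcal G^0$. Let $\mathcal G^Y_Y=\{g\in\mathcal G : s(g),r(g)\in Y\}$ be the reduction of $\mathcal G$ to $Y$, an ample groupoid with compact unit space $Y$, and regard $\mathbb Z\mathcal G^Y_Y$ as a subring (with identity $1_Y$) of $\mathbb Z\mathcal G$ via extension by $0$. Then for every unital (equivalently, unitary) left $\mathbb Z\mathcal G$-module $M$ and every $n\ge 0$ there is an isomorphism of abelian groups $$H_n(\mathcal G,M)\cong H_n(\mathcal G^Y_Y,1_YM),$$ where $\mathbb Z\mathcal G^Y_Y$ acts on $1_YM=\{1_Ym : m\in M\}$ by restriction of the action of $\mathbb Z\mathcal G$. In particular, $H_n(\mathcal G)\cong H_n(\mathcal G^Y_Y)$ for every $n\ge 0$. -/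

import Mathlib

open CategoryTheory TopologicalSpace
open scoped TensorProduct Topology

universe u v w

noncomputable section

/-! ### Balanced tensor products and `Tor` over an arbitrary ring -/

namespace Balanced

/-- The subgroup of `N ⊗[ℤ] M` generated by the elements `(n·a) ⊗ m - n ⊗ (a·m)`. A right
`A`-module is a module over `Aᵐᵒᵖ`, so that `n·a` is `MulOpposite.op a • n`. -/
def relations (A : Type u) [Ring A] (N : Type w) [AddCommGroup N] [Module Aᵐᵒᵖ N]
    (M : Type v) [AddCommGroup M] [Module A M] : AddSubgroup (N ⊗[ℤ] M) :=
  AddSubgroup.closure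
    {t | ∃ (n : N) (a : A) (m : M), t = (MulOpposite.op a • n) ⊗ₜ[ℤ] m - n ⊗ₜ[ℤ] (a • m)}

/-- The abelian group `N ⊗_A M`, for a right `A`-module `N` and a left `A`-module `M`. -/
abbrev Tensor (A : Type u) [Ring A] (N : Type w) [AddCommGroup N] [Module Aᵐᵒᵖ N]
    (M : Type v) [AddCommGroup M] [Module A M] : Type (max w v) :=
  (N ⊗[ℤ] M) ⧸ relations A N M

/-- The homomorphism `f ⊗ id : N ⊗_A M → N' ⊗_A M`. -/
def Tensor.map {A : Type u} [Ring A] {N N' : Type w} [AddCommGroup N] [Module Aᵐᵒᵖ N]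
    [AddCommGroup N'] [Module Aᵐᵒᵖ N'] (M : Type v) [AddCommGroup M] [Module A M]
    (f : N →ₗ[Aᵐᵒᵖ] N') : Tensor A N M →+ Tensor A N' M :=
  QuotientAddGroup.map _ _ (LinearMap.rTensor M f.toAddMonoidHom.toIntLinearMap).toAddMonoidHom <| by
    refine (AddSubgroup.closure_le _).2 ?_
    rintro _ ⟨n, a, m, rfl⟩
    refine AddSubgroup.subset_closure ⟨f n, a, m, ?_⟩
    simp

/-- The class of `n ⊗ m` in `N ⊗_A M`. -/
def Tensor.tmul (A : Type u) [Ring A] {N : Type w} [AddCommGroup N] [Module Aᵐᵒᵖ N]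
    {M : Type v} [AddCommGroup M] [Module A M] (n : N) (m : M) : Tensor A N M :=
  QuotientAddGroup.mk (n ⊗ₜ[ℤ] m)

lemma Tensor.hom_ext {A : Type u} [Ring A] {N : Type w} [AddCommGroup N] [Module Aᵐᵒᵖ N]
    {M : Type v} [AddCommGroup M] [Module A M] {P : Type*} [AddCommGroup P]
    {f g : Tensor A N M →+ P}
    (h : ∀ n m, f (Tensor.tmul A n m) = g (Tensor.tmul A n m)) : f = g := by
  ext x
  induction x using TensorProduct.induction_on with
  | zero => simp
  | tmul n m => exact h n m
  | add x y hx hy => rw [map_add, map_add, hx, hy]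

/-- The functor `N ↦ N ⊗_A M` from right `A`-modules to abelian groups. -/
def tensorFunctor (A : Type u) [Ring A] (M : Type v) [AddCommGroup M] [Module A M] :
    ModuleCat.{w} Aᵐᵒᵖ ⥤ AddCommGrpCat.{max w v} where
  obj N := AddCommGrpCat.of (Tensor A N M)
  map f := AddCommGrpCat.ofHom (Tensor.map M f.hom)
  map_id N := congrArg AddCommGrpCat.ofHom
    (Tensor.hom_ext (g := AddMonoidHom.id (Tensor A N M)) fun _ _ => rfl)
  map_comp f g := congrArg AddCommGrpCat.ofHom
    (Tensor.hom_ext (g := (Tensor.map M g.hom).comp (Tensor.map M f.hom)) fun _ _ => rfl)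

instance (A : Type u) [Ring A] (M : Type v) [AddCommGroup M] [Module A M] :
    (tensorFunctor.{u, v, w} A M).Additive where
  map_add {_ N' f g} := congrArg AddCommGrpCat.ofHom
    (Tensor.hom_ext (g := Tensor.map M f.hom + Tensor.map M g.hom) fun n m =>
      congrArg (QuotientAddGroup.mk (s := relations A N' M))
        (TensorProduct.add_tmul (f.hom n) (g.hom n) m))

/-- `Tor_n^A(N, M)`, for a right `A`-module `N` and a left `A`-module `M`: the value at `N` of
the `n`-th left derived functor of `- ⊗_A M`. -/
def Tor (A : Type u) [Ring A] (n : ℕ) (N : Type u) [AddCommGroup N] [Module Aᵐᵒᵖ N]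
    (M : Type v) [AddCommGroup M] [Module A M] : AddCommGrpCat.{max u v} :=
  ((tensorFunctor.{u, v, u} A M).leftDerived n).obj (ModuleCat.of Aᵐᵒᵖ N)

end Balanced

/-! ### Ample groupoids -/

/-- An ample groupoid: a topological groupoid with space of arrows `Arr` and unit space `Obj`,
embedded into `Arr` by `one`, such that the unit space is locally compact, Hausdorff and totally
disconnected and the source map is a local homeomorphism. The space of arrows need not be
Hausdorff. The product `ab` is defined when `src a = rng b`. -/
structure AmpleGroupoid where
  /-- the unit space -/
  Obj : Type u
  /-- the space of arrows -/
  Arr : Type u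
  [topObj : TopologicalSpace Obj]
  [topArr : TopologicalSpace Arr]
  src : Arr → Obj
  rng : Arr → Obj
  one : Obj → Arr
  mul : (a b : Arr) → src a = rng b → Arr
  inv : Arr → Arr
  src_one : ∀ x, src (one x) = x
  rng_one : ∀ x, rng (one x) = x
  src_mul : ∀ a b h, src (mul a b h) = src b
  rng_mul : ∀ a b h, rng (mul a b h) = rng a
  src_inv : ∀ a, src (inv a) = rng a
  rng_inv : ∀ a, rng (inv a) = src a
  one_mul : ∀ a, mul (one (rng a)) a (src_one _) = a
  mul_one : ∀ a, mul a (one (src a)) (rng_one _).symm = a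
  inv_mul : ∀ a, mul (inv a) a (src_inv a) = one (src a)
  mul_inv : ∀ a, mul a (inv a) (rng_inv a).symm = one (rng a)
  mul_assoc : ∀ a b c (hab : src a = rng b) (hbc : src b = rng c),
    mul (mul a b hab) c ((src_mul a b hab).trans hbc) =
      mul a (mul b c hbc) (hab.trans (rng_mul b c hbc).symm)
  continuous_rng : Continuous rng
  continuous_one : Continuous one
  continuous_mul : Continuous fun p : {p : Arr × Arr // src p.1 = rng p.2} =>
    mul p.1.1 p.1.2 p.2
  continuous_inv : Continuous inv
  [locallyCompact : LocallyCompactSpace Obj]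
  [t2 : T2Space Obj]
  [totallyDisconnected : TotallyDisconnectedSpace Obj]
  isLocalHomeomorph_src : IsLocalHomeomorph src

/-- For a space `X` with a basis of compact open sets, the group `ℤX` of functions `X → ℤ`
generated by the characteristic functions of the compact open subsets, where compact means
quasi-compact and Hausdorff. -/
def ZFun (X : Type u) [TopologicalSpace X] : AddSubgroup (X → ℤ) :=
  AddSubgroup.closure
    {f | ∃ U : Set X, IsOpen U ∧ IsCompact U ∧ T2Space U ∧ f = U.indicator 1}

namespace AmpleGroupoid

attribute [instance] topObj topArr locallyCompact t2 totallyDisconnected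

variable (𝒢 : AmpleGroupoid.{u})

lemma continuous_src : Continuous 𝒢.src := 𝒢.isLocalHomeomorph_src.continuous

lemma inv_unique {a b : 𝒢.Arr} (h : 𝒢.src a = 𝒢.rng b)
    (hab : 𝒢.mul a b h = 𝒢.one (𝒢.rng a)) : b = 𝒢.inv a := by
  have h1 := 𝒢.mul_assoc (𝒢.inv a) a b (𝒢.src_inv a) h
  have h2 : 𝒢.mul (𝒢.mul (𝒢.inv a) a (𝒢.src_inv a)) b
      ((𝒢.src_mul _ _ _).trans h) = b := by
    have := 𝒢.one_mul b
    simp only [𝒢.inv_mul, h]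
    exact this
  rw [h2] at h1
  rw [h1]
  have := 𝒢.mul_one (𝒢.inv a)
  simp only [hab, ← 𝒢.src_inv a]
  exact this

lemma inv_inv (a : 𝒢.Arr) : 𝒢.inv (𝒢.inv a) = a := by
  symm
  apply 𝒢.inv_unique (𝒢.src_inv a)
  rw [𝒢.inv_mul, 𝒢.rng_inv]

/-- `a⁻¹(ab) = b`. -/
lemma inv_mul_cancel_left (a b : 𝒢.Arr) (h : 𝒢.src a = 𝒢.rng b) :
    𝒢.mul (𝒢.inv a) (𝒢.mul a b h) ((𝒢.src_inv a).trans (𝒢.rng_mul a b h).symm) = b := by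
  rw [← 𝒢.mul_assoc (𝒢.inv a) a b (𝒢.src_inv a) h]
  have := 𝒢.one_mul b
  simp only [𝒢.inv_mul, h]
  exact this

/-- `a(a⁻¹g) = g`. -/
lemma mul_inv_cancel_left (a g : 𝒢.Arr) (h : 𝒢.rng a = 𝒢.rng g) :
    𝒢.mul a (𝒢.mul (𝒢.inv a) g ((𝒢.src_inv a).trans h))
      ((𝒢.rng_inv a).symm.trans (𝒢.rng_mul _ _ _).symm) = g := by
  rw [← 𝒢.mul_assoc a (𝒢.inv a) g (𝒢.rng_inv a).symm ((𝒢.src_inv a).trans h)]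
  have := 𝒢.one_mul g
  simp only [𝒢.mul_inv, h]
  exact this

lemma isLocalHomeomorph_rng : IsLocalHomeomorph 𝒢.rng := by
  have : 𝒢.rng = 𝒢.src ∘ 𝒢.inv := by ext a; simp [𝒢.src_inv]
  rw [this]
  let e : 𝒢.Arr ≃ₜ 𝒢.Arr :=
    { toFun := 𝒢.inv, invFun := 𝒢.inv, left_inv := 𝒢.inv_inv, right_inv := 𝒢.inv_inv
      continuous_toFun := 𝒢.continuous_inv, continuous_invFun := 𝒢.continuous_inv }
  exact 𝒢.isLocalHomeomorph_src.comp e.isLocalHomeomorph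

lemma isLocalHomeomorph_one : IsLocalHomeomorph 𝒢.one := by
  refine IsLocalHomeomorph.of_comp (g := 𝒢.src) ?_ 𝒢.isLocalHomeomorph_src 𝒢.continuous_one
  have : 𝒢.src ∘ 𝒢.one = id := funext 𝒢.src_one
  rw [this]
  exact (Homeomorph.refl _).isLocalHomeomorph

/-! #### Compact bisections -/

/-- Compact (open) bisections. -/
structure IsBisection (U : Set 𝒢.Arr) : Prop where
  isOpen : IsOpen U
  isCompact : IsCompact U
  src_inj : Set.InjOn 𝒢.src U
  rng_inj : Set.InjOn 𝒢.rng U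

variable {𝒢}

lemma IsBisection.t2 {U : Set 𝒢.Arr} (hU : 𝒢.IsBisection U) : T2Space U :=
  T2Space.of_injective_continuous (f := fun x : U => 𝒢.src x)
    (fun x y h => Subtype.ext (hU.src_inj x.2 y.2 h))
    (𝒢.continuous_src.comp continuous_subtype_val)

lemma IsBisection.mem_ZFun {U : Set 𝒢.Arr} (hU : 𝒢.IsBisection U) :
    U.indicator 1 ∈ ZFun 𝒢.Arr :=
  AddSubgroup.subset_closure ⟨U, hU.isOpen, hU.isCompact, hU.t2, rfl⟩

lemma exists_bisection {U : Set 𝒢.Arr} (hU : IsOpen U) {g : 𝒢.Arr} (hg : g ∈ U) :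
    ∃ V, 𝒢.IsBisection V ∧ g ∈ V ∧ V ⊆ U := by
  obtain ⟨e, hge, he⟩ := 𝒢.isLocalHomeomorph_src g
  obtain ⟨e', hge', he'⟩ := 𝒢.isLocalHomeomorph_rng g
  set W := U ∩ (e.source ∩ e'.source) with hW
  have hWo : IsOpen W := hU.inter (e.open_source.inter e'.open_source)
  have hgW : g ∈ W := ⟨hg, hge, hge'⟩
  have hWs : W ⊆ e.source := fun x hx => hx.2.1
  have hsW : IsOpen (e '' W) := e.isOpen_image_of_subset_source hWo hWs
  obtain ⟨K, hKc, hKg, hKW⟩ := exists_compact_subset hsW (Set.mem_image_of_mem e hgW)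
  obtain ⟨C, hC, hgC, hCK⟩ := loc_compact_Haus_tot_disc_of_zero_dim.mem_nhds_iff.1
    (isOpen_interior.mem_nhds hKg)
  have hCc : IsCompact C := hKc.of_isClosed_subset hC.1 (hCK.trans interior_subset)
  have hCW : C ⊆ e '' W := hCK.trans (interior_subset.trans hKW)
  have himg : e.symm '' C = W ∩ e ⁻¹' C := by
    ext x
    constructor
    · rintro ⟨y, hy, rfl⟩
      obtain ⟨z, hz, rfl⟩ := hCW hy
      rw [e.left_inv (hWs hz)]
      exact ⟨hz, hy⟩
    · rintro ⟨hx, hxC⟩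
      exact ⟨e x, hxC, e.left_inv (hWs hx)⟩
  have hCt : C ⊆ e.target := by
    intro y hy
    obtain ⟨z, hz, rfl⟩ := hCW hy
    exact e.map_source (hWs hz)
  refine ⟨W ∩ e ⁻¹' C, ⟨?_, ?_, ?_, ?_⟩, ⟨hgW, hgC⟩, fun x hx => hx.1.1⟩
  · rw [← himg]
    exact e.symm.isOpen_image_of_subset_source hC.2 hCt
  · rw [← himg]
    exact hCc.image_of_continuousOn (e.continuousOn_symm.mono hCt)
  · rw [he]
    exact e.injOn.mono fun x hx => hx.1.2.1
  · rw [he']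
    exact e'.injOn.mono fun x hx => hx.1.2.2

variable (𝒢) in
/-- The group `ℤ𝒢` is generated by the characteristic functions of compact bisections. -/
lemma ZFun_eq_closure_bisection :
    ZFun 𝒢.Arr = AddSubgroup.closure {f | ∃ U, 𝒢.IsBisection U ∧ f = U.indicator 1} := by
  apply le_antisymm
  · refine (AddSubgroup.closure_le _).2 ?_
    rintro _ ⟨U, hUo, hUc, hUt, rfl⟩
    choose! V hV hgV hVU using fun (g : 𝒢.Arr) (hg : g ∈ U) => exists_bisection hUo hg
    obtain ⟨t, htU, ht⟩ := hUc.elim_nhds_subcover V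
      (fun g hg => (hV g hg).isOpen.mem_nhds (hgV g hg))
    have hU : U = ⋃ g ∈ t, V g :=
      ht.antisymm (Set.iUnion₂_subset fun g hg => hVU g (htU g hg))
    have key : ∀ t : Finset 𝒢.Arr, (∀ g ∈ t, g ∈ U) →
        (⋃ g ∈ t, V g).indicator (1 : 𝒢.Arr → ℤ) ∈
          AddSubgroup.closure {f | ∃ U, 𝒢.IsBisection U ∧ f = U.indicator 1} := by
      classical
      intro t
      induction t using Finset.induction_on with
      | empty =>
        intro _
        simp only [Finset.notMem_empty, Set.iUnion_of_empty, Set.iUnion_empty,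
          Set.indicator_empty]
        exact AddSubgroup.zero_mem _
      | insert g t hgt ih =>
        intro hsub
        have hg := hsub g (Finset.mem_insert_self g t)
        have hts : ∀ x ∈ t, x ∈ U := fun x hx => hsub x (Finset.mem_insert_of_mem hx)
        have ih := ih hts
        set W := ⋃ x ∈ t, V x with hW
        have hWU : W ⊆ U := Set.iUnion₂_subset fun x hx => hVU x (hts x hx)
        have hWo : IsOpen W := isOpen_biUnion fun x hx => (hV x (hts x hx)).isOpen
        have hWc : IsCompact W := t.isCompact_biUnion fun x hx => (hV x (hts x hx)).isCompact
        have hcl : IsClosed ((↑) ⁻¹' W : Set U) := by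
          have : IsCompact ((↑) ⁻¹' W : Set U) := by
            rw [Subtype.isCompact_iff, Subtype.image_preimage_coe,
              Set.inter_eq_right.2 hWU]
            exact hWc
          exact this.isClosed
        have hUW : IsOpen (U \ W) := by
          have := hUo.isOpenMap_subtype_val _ hcl.isOpen_compl
          convert this using 1
          ext x
          simp
        have hb : 𝒢.IsBisection (V g \ W) := by
          have e : V g \ W = V g ∩ (U \ W) := by
            ext x
            exact ⟨fun h => ⟨h.1, hVU g hg h.1, h.2⟩, fun h => ⟨h.1, h.2.2⟩⟩
          refine ⟨?_, ?_, (hV g hg).src_inj.mono Set.sdiff_subset,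
            (hV g hg).rng_inj.mono Set.sdiff_subset⟩
          · rw [e]
            exact (hV g hg).isOpen.inter hUW
          · exact (hV g hg).isCompact.diff hWo
        have hsum : (⋃ x ∈ insert g t, V x).indicator (1 : 𝒢.Arr → ℤ) =
            (V g \ W).indicator 1 + W.indicator 1 := by
          rw [Finset.set_biUnion_insert, ← hW]
          ext x
          by_cases h1 : x ∈ V g <;> by_cases h2 : x ∈ W <;> simp [h1, h2]
        rw [hsum]
        exact add_mem (AddSubgroup.subset_closure ⟨_, hb, rfl⟩) ih
    rw [hU]
    exact key t htU
  · refine (AddSubgroup.closure_le _).2 ?_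
    rintro _ ⟨U, hU, rfl⟩
    exact hU.mem_ZFun

/-! #### Bilinear expressions given by fibrewise finite sums -/

section Pairing

variable {α β γ : Type*} {I : γ → Type*} (p : ∀ z, I z → α) (q : ∀ z, I z → β)

/-- The function `z ↦ ∑ f(p i) h(q i)`, where `i` ranges over `I z`. -/
def pairing (f : α → ℤ) (h : β → ℤ) (z : γ) : ℤ := ∑ᶠ i : I z, f (p z i) * h (q z i)

/-- The sums over `I z` of expressions in `f` have only finitely many nonzero terms. -/
def FinOn (f : α → ℤ) : Prop := ∀ z, {i : I z | f (p z i) ≠ 0}.Finite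

variable {p}

lemma FinOn.add {f f' : α → ℤ} (hf : FinOn p f) (hf' : FinOn p f') : FinOn p (f + f') :=
  fun z => ((hf z).union (hf' z)).subset fun i hi => by
    by_contra h
    simp only [Set.mem_union, Set.mem_ofPred_eq, not_or, not_not] at h
    exact hi (by simp [h.1, h.2])

lemma FinOn.neg {f : α → ℤ} (hf : FinOn p f) : FinOn p (-f) :=
  fun z => (hf z).subset fun i hi h => hi (by simp [h])

lemma FinOn.zero : FinOn p (0 : α → ℤ) := fun z => by simp

lemma FinOn.support {f : α → ℤ} (hf : FinOn p f) (h : β → ℤ) (z : γ) :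
    (Function.support fun i : I z => f (p z i) * h (q z i)).Finite :=
  (hf z).subset fun _ hi => left_ne_zero_of_mul hi

variable {q}

lemma pairing_add_left {f f' : α → ℤ} (hf : FinOn p f) (hf' : FinOn p f') (h : β → ℤ) :
    pairing p q (f + f') h = pairing p q f h + pairing p q f' h := by
  ext z
  simp only [pairing, Pi.add_apply, add_mul]
  exact finsum_add_distrib (hf.support q h z) (hf'.support q h z)

lemma pairing_add_right {f : α → ℤ} (hf : FinOn p f) (h h' : β → ℤ) :
    pairing p q f (h + h') = pairing p q f h + pairing p q f h' := by
  ext z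
  simp only [pairing, Pi.add_apply, mul_add]
  exact finsum_add_distrib (hf.support q h z) (hf.support q h' z)

lemma pairing_neg_left (f : α → ℤ) (h : β → ℤ) :
    pairing p q (-f) h = -pairing p q f h := by
  ext z
  simp [pairing, finsum_neg_distrib]

lemma pairing_neg_right (f : α → ℤ) (h : β → ℤ) :
    pairing p q f (-h) = -pairing p q f h := by
  ext z
  simp [pairing, finsum_neg_distrib]

lemma pairing_zero_left (h : β → ℤ) : pairing p q 0 h = 0 := by
  ext z
  simp [pairing]

lemma pairing_zero_right (f : α → ℤ) : pairing p q f 0 = 0 := by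
  ext z
  simp [pairing]

lemma finOn_of_mem {S : Set (α → ℤ)} (hS : ∀ f ∈ S, FinOn p f) {f : α → ℤ}
    (hf : f ∈ AddSubgroup.closure S) : FinOn p f := by
  induction hf using AddSubgroup.closure_induction with
  | mem f hf => exact hS f hf
  | zero => exact FinOn.zero
  | add f g _ _ hf hg => exact hf.add hg
  | neg f _ hf => exact hf.neg

lemma pairing_mem {S : Set (α → ℤ)} (hS : ∀ f ∈ S, FinOn p f) {T : Set (β → ℤ)}
    {C : AddSubgroup (γ → ℤ)} (hC : ∀ f ∈ S, ∀ h ∈ T, pairing p q f h ∈ C) {f : α → ℤ}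
    (hf : f ∈ AddSubgroup.closure S) {h : β → ℤ} (hh : h ∈ AddSubgroup.closure T) :
    pairing p q f h ∈ C := by
  induction hf using AddSubgroup.closure_induction with
  | mem f hf =>
    induction hh using AddSubgroup.closure_induction with
    | mem h hh => exact hC f hf h hh
    | zero => rw [pairing_zero_right]; exact C.zero_mem
    | add h h' _ _ ih ih' => rw [pairing_add_right (hS f hf)]; exact C.add_mem ih ih'
    | neg h _ ih => rw [pairing_neg_right]; exact C.neg_mem ih
  | zero => rw [pairing_zero_left]; exact C.zero_mem
  | add f f' hf hf' ih ih' =>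
    rw [pairing_add_left (finOn_of_mem hS hf) (finOn_of_mem hS hf')]
    exact C.add_mem ih ih'
  | neg f _ ih => rw [pairing_neg_left]; exact C.neg_mem ih

end Pairing

/-! #### Convolution and the trivial modules -/

variable (𝒢)

/-- Convolution: `(f * h)(g) = ∑_{r(a) = r(g)} f(a) h(a⁻¹g)`. -/
def conv (f h : 𝒢.Arr → ℤ) (g : 𝒢.Arr) : ℤ :=
  ∑ᶠ a : {a : 𝒢.Arr // 𝒢.rng a = 𝒢.rng g},
    f a.1 * h (𝒢.mul (𝒢.inv a.1) g ((𝒢.src_inv a.1).trans a.2))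

/-- The left action of `ℤ𝒢` on `ℤ𝒢⁰`: `(f h)(x) = ∑_{r(g) = x} f(g) h(s(g))`. -/
def leftAct (f : 𝒢.Arr → ℤ) (h : 𝒢.Obj → ℤ) (x : 𝒢.Obj) : ℤ :=
  ∑ᶠ g : {g : 𝒢.Arr // 𝒢.rng g = x}, f g.1 * h (𝒢.src g.1)

/-- The right action of `ℤ𝒢` on `ℤ𝒢⁰`: `(h f)(x) = ∑_{s(g) = x} h(r(g)) f(g)`. -/
def rightAct (h : 𝒢.Obj → ℤ) (f : 𝒢.Arr → ℤ) (x : 𝒢.Obj) : ℤ :=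
  ∑ᶠ g : {g : 𝒢.Arr // 𝒢.src g = x}, h (𝒢.rng g.1) * f g.1

lemma conv_eq_pairing : 𝒢.conv = pairing
    (I := fun g : 𝒢.Arr => {a : 𝒢.Arr // 𝒢.rng a = 𝒢.rng g}) (fun _ a => a.1)
    (fun g a => 𝒢.mul (𝒢.inv a.1) g ((𝒢.src_inv a.1).trans a.2)) := rfl

lemma leftAct_eq_pairing : 𝒢.leftAct = pairing
    (I := fun x : 𝒢.Obj => {g : 𝒢.Arr // 𝒢.rng g = x}) (fun _ a => a.1)
    (fun _ a => 𝒢.src a.1) := rfl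

lemma rightAct_eq_pairing (h : 𝒢.Obj → ℤ) (f : 𝒢.Arr → ℤ) : 𝒢.rightAct h f = pairing
    (I := fun x : 𝒢.Obj => {g : 𝒢.Arr // 𝒢.src g = x}) (fun _ a => a.1)
    (fun _ a => 𝒢.rng a.1) f h := by
  ext x
  simp only [rightAct, pairing, mul_comm]

/-- The characteristic functions of compact bisections. -/
def bisectionInd : Set (𝒢.Arr → ℤ) := {f | ∃ U, 𝒢.IsBisection U ∧ f = U.indicator 1}

/-- The characteristic functions of compact open subsets of the unit space. -/
def unitInd : Set (𝒢.Obj → ℤ) := {f | ∃ K, IsOpen K ∧ IsCompact K ∧ f = K.indicator 1}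

lemma ZFun_obj_eq : ZFun 𝒢.Obj = AddSubgroup.closure 𝒢.unitInd := by
  unfold ZFun unitInd
  congr 1
  ext f
  exact ⟨fun ⟨U, h1, h2, _, h3⟩ => ⟨U, h1, h2, h3⟩,
    fun ⟨U, h1, h2, h3⟩ => ⟨U, h1, h2, inferInstance, h3⟩⟩

lemma ZFun_arr_eq : ZFun 𝒢.Arr = AddSubgroup.closure 𝒢.bisectionInd :=
  𝒢.ZFun_eq_closure_bisection

lemma finOn_rng : ∀ f ∈ 𝒢.bisectionInd,
    FinOn (I := fun x : 𝒢.Obj => {g : 𝒢.Arr // 𝒢.rng g = x}) (fun _ a => a.1) f := by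
  rintro _ ⟨U, hU, rfl⟩ x
  refine Set.Subsingleton.finite fun a ha b hb => Subtype.ext (hU.rng_inj ?_ ?_ ?_)
  · exact Set.mem_of_indicator_ne_zero ha
  · exact Set.mem_of_indicator_ne_zero hb
  · exact a.2.trans b.2.symm

lemma finOn_conv : ∀ f ∈ 𝒢.bisectionInd,
    FinOn (I := fun g : 𝒢.Arr => {a : 𝒢.Arr // 𝒢.rng a = 𝒢.rng g}) (fun _ a => a.1) f :=
  fun f hf g => 𝒢.finOn_rng f hf (𝒢.rng g)

lemma finOn_src : ∀ f ∈ 𝒢.bisectionInd,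
    FinOn (I := fun x : 𝒢.Obj => {g : 𝒢.Arr // 𝒢.src g = x}) (fun _ a => a.1) f := by
  rintro _ ⟨U, hU, rfl⟩ x
  refine Set.Subsingleton.finite fun a ha b hb => Subtype.ext (hU.src_inj ?_ ?_ ?_)
  · exact Set.mem_of_indicator_ne_zero ha
  · exact Set.mem_of_indicator_ne_zero hb
  · exact a.2.trans b.2.symm

/-- The setwise product of sets of arrows. -/
def setMul (U V : Set 𝒢.Arr) : Set 𝒢.Arr :=
  {g | ∃ a ∈ U, ∃ b ∈ V, ∃ h : 𝒢.src a = 𝒢.rng b, 𝒢.mul a b h = g}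

/-- The set of ranges of arrows in `U` with source in `K`. -/
def setLeft (U : Set 𝒢.Arr) (K : Set 𝒢.Obj) : Set 𝒢.Obj := 𝒢.rng '' (U ∩ 𝒢.src ⁻¹' K)

/-- The set of sources of arrows in `U` with range in `K`. -/
def setRight (K : Set 𝒢.Obj) (U : Set 𝒢.Arr) : Set 𝒢.Obj := 𝒢.src '' (U ∩ 𝒢.rng ⁻¹' K)

variable {𝒢}

lemma isOpen_setMul {U V : Set 𝒢.Arr} (hU : IsOpen U) (hV : IsOpen V) :
    IsOpen (𝒢.setMul U V) := by
  rw [isOpen_iff_mem_nhds]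
  rintro g ⟨a, ha, b, hb, h, rfl⟩
  set g := 𝒢.mul a b h with hg
  obtain ⟨e, hae, he⟩ := 𝒢.isLocalHomeomorph_rng a
  have hrg : 𝒢.rng g = e a := by rw [hg, 𝒢.rng_mul, he]
  have hat : e a ∈ e.target := e.map_source hae
  -- the local section of the range map through `a`
  have hσ : Filter.Tendsto (fun x => e.symm (𝒢.rng x)) (𝓝 g) (𝓝 a) := by
    have h1 : Filter.Tendsto e.symm (𝓝 (e a)) (𝓝 a) := by
      have := e.continuousAt_symm hat
      unfold ContinuousAt at this
      rwa [e.left_inv hae] at this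
    have h2 : Filter.Tendsto 𝒢.rng (𝓝 g) (𝓝 (e a)) := by
      rw [← hrg]
      exact 𝒢.continuous_rng.tendsto g
    exact h1.comp h2
  have htar : ∀ᶠ x in 𝓝 g, 𝒢.rng x ∈ e.target := by
    refine (𝒢.continuous_rng.tendsto g).eventually ?_
    rw [hrg]
    exact e.open_target.mem_nhds hat
  have hsec : ∀ x, 𝒢.rng x ∈ e.target → 𝒢.rng (e.symm (𝒢.rng x)) = 𝒢.rng x := by
    intro x hx
    exact (congrFun he _).trans (e.right_inv hx)
  have hVn : V ∈ 𝓝 (𝒢.mul (𝒢.inv a) g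
      ((𝒢.src_inv a).trans (𝒢.rng_mul a b h).symm)) := by
    rw [𝒢.inv_mul_cancel_left]
    exact hV.mem_nhds hb
  have hm := 𝒢.continuous_mul.continuousAt.preimage_mem_nhds
    (x := ⟨(𝒢.inv a, g), (𝒢.src_inv a).trans (𝒢.rng_mul a b h).symm⟩) hVn
  rw [nhds_subtype_eq_comap, Filter.mem_comap] at hm
  obtain ⟨T, hT, hTV⟩ := hm
  have hpair : Filter.Tendsto (fun x => (𝒢.inv (e.symm (𝒢.rng x)), x)) (𝓝 g)
      (𝓝 (𝒢.inv a, g)) :=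
    ((𝒢.continuous_inv.tendsto a).comp hσ).prodMk_nhds Filter.tendsto_id
  filter_upwards [hσ.eventually (hU.mem_nhds ha), htar, hpair hT] with x hxU hxt hxT
  have hr := hsec x hxt
  refine ⟨_, hxU, _, ?_, _, 𝒢.mul_inv_cancel_left _ x hr⟩
  exact hTV (a := ⟨(𝒢.inv (e.symm (𝒢.rng x)), x), (𝒢.src_inv _).trans hr⟩) hxT

lemma isCompact_setMul {U V : Set 𝒢.Arr} (hU : IsCompact U) (hV : IsCompact V) :
    IsCompact (𝒢.setMul U V) := by
  have hcl : IsClosed {p : 𝒢.Arr × 𝒢.Arr | 𝒢.src p.1 = 𝒢.rng p.2} :=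
    isClosed_eq (𝒢.continuous_src.comp continuous_fst) (𝒢.continuous_rng.comp continuous_snd)
  have hc := hcl.isClosedEmbedding_subtypeVal.isCompact_preimage (hU.prod hV)
  convert hc.image 𝒢.continuous_mul using 1
  ext g
  constructor
  · rintro ⟨a, ha, b, hb, h, rfl⟩
    exact ⟨⟨(a, b), h⟩, ⟨ha, hb⟩, rfl⟩
  · rintro ⟨⟨⟨a, b⟩, h⟩, ⟨ha, hb⟩, rfl⟩
    exact ⟨a, ha, b, hb, h, rfl⟩

lemma IsBisection.setMul {U V : Set 𝒢.Arr} (hU : 𝒢.IsBisection U) (hV : 𝒢.IsBisection V) :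
    𝒢.IsBisection (𝒢.setMul U V) where
  isOpen := isOpen_setMul hU.isOpen hV.isOpen
  isCompact := isCompact_setMul hU.isCompact hV.isCompact
  src_inj := by
    rintro _ ⟨a, ha, b, hb, h, rfl⟩ _ ⟨a', ha', b', hb', h', rfl⟩ e
    rw [𝒢.src_mul, 𝒢.src_mul] at e
    obtain rfl := hV.src_inj hb hb' e
    obtain rfl := hU.src_inj ha ha' (h.trans h'.symm)
    rfl
  rng_inj := by
    rintro _ ⟨a, ha, b, hb, h, rfl⟩ _ ⟨a', ha', b', hb', h', rfl⟩ e
    rw [𝒢.rng_mul, 𝒢.rng_mul] at e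
    obtain rfl := hU.rng_inj ha ha' e
    obtain rfl := hV.rng_inj hb hb' (h.symm.trans h')
    rfl

lemma isOpen_setLeft {U : Set 𝒢.Arr} {K : Set 𝒢.Obj} (hU : IsOpen U) (hK : IsOpen K) :
    IsOpen (𝒢.setLeft U K) :=
  𝒢.isLocalHomeomorph_rng.isOpenMap _ (hU.inter (hK.preimage 𝒢.continuous_src))

lemma isCompact_setLeft {U : Set 𝒢.Arr} {K : Set 𝒢.Obj} (hU : IsCompact U)
    (hK : IsCompact K) : IsCompact (𝒢.setLeft U K) :=
  (hU.inter_right (hK.isClosed.preimage 𝒢.continuous_src)).image 𝒢.continuous_rng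

lemma isOpen_setRight {U : Set 𝒢.Arr} {K : Set 𝒢.Obj} (hK : IsOpen K) (hU : IsOpen U) :
    IsOpen (𝒢.setRight K U) :=
  𝒢.isLocalHomeomorph_src.isOpenMap _ (hU.inter (hK.preimage 𝒢.continuous_rng))

lemma isCompact_setRight {U : Set 𝒢.Arr} {K : Set 𝒢.Obj} (hK : IsCompact K)
    (hU : IsCompact U) : IsCompact (𝒢.setRight K U) :=
  (hU.inter_right (hK.isClosed.preimage 𝒢.continuous_rng)).image 𝒢.continuous_src

lemma conv_indicator {U V : Set 𝒢.Arr} (hU : 𝒢.IsBisection U) :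
    𝒢.conv (U.indicator 1) (V.indicator 1) = (𝒢.setMul U V).indicator 1 := by
  ext g
  unfold conv
  by_cases hg : g ∈ 𝒢.setMul U V
  · rw [Set.indicator_of_mem hg]
    obtain ⟨a, ha, b, hb, h, rfl⟩ := hg
    rw [finsum_eq_single _ ⟨a, (𝒢.rng_mul a b h).symm⟩]
    · simp only [𝒢.inv_mul_cancel_left]
      simp [ha, hb]
    · intro c hc
      rw [Set.indicator_of_notMem (fun hcU => hc ?_), zero_mul]
      exact Subtype.ext (hU.rng_inj hcU ha (c.2.trans (𝒢.rng_mul a b h)))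
  · rw [Set.indicator_of_notMem hg]
    refine (finsum_congr fun c => ?_).trans finsum_zero
    by_contra hne
    exact hg ⟨c.1, Set.mem_of_indicator_ne_zero (left_ne_zero_of_mul hne), _,
      Set.mem_of_indicator_ne_zero (right_ne_zero_of_mul hne), _,
      𝒢.mul_inv_cancel_left c.1 g c.2⟩

lemma leftAct_indicator {U : Set 𝒢.Arr} {K : Set 𝒢.Obj} (hU : 𝒢.IsBisection U) :
    𝒢.leftAct (U.indicator 1) (K.indicator 1) = (𝒢.setLeft U K).indicator 1 := by
  ext x
  unfold leftAct
  by_cases hx : x ∈ 𝒢.setLeft U K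
  · rw [Set.indicator_of_mem hx]
    obtain ⟨a, ⟨ha, haK⟩, rfl⟩ := hx
    rw [finsum_eq_single _ ⟨a, rfl⟩]
    · simp only [Set.mem_preimage] at haK
      simp [ha, haK]
    · intro c hc
      rw [Set.indicator_of_notMem (fun hcU => hc ?_), zero_mul]
      exact Subtype.ext (hU.rng_inj hcU ha c.2)
  · rw [Set.indicator_of_notMem hx]
    refine (finsum_congr fun c => ?_).trans finsum_zero
    by_contra hne
    have h1 : c.1 ∈ U := Set.mem_of_indicator_ne_zero (left_ne_zero_of_mul hne)
    have h2 : 𝒢.src c.1 ∈ K := Set.mem_of_indicator_ne_zero (right_ne_zero_of_mul hne)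
    exact hx ⟨c.1, ⟨h1, h2⟩, c.2⟩

lemma rightAct_indicator {U : Set 𝒢.Arr} {K : Set 𝒢.Obj} (hU : 𝒢.IsBisection U) :
    𝒢.rightAct (K.indicator 1) (U.indicator 1) = (𝒢.setRight K U).indicator 1 := by
  ext x
  unfold rightAct
  by_cases hx : x ∈ 𝒢.setRight K U
  · rw [Set.indicator_of_mem hx]
    obtain ⟨a, ⟨ha, haK⟩, rfl⟩ := hx
    rw [finsum_eq_single _ ⟨a, rfl⟩]
    · simp only [Set.mem_preimage] at haK
      simp [ha, haK]
    · intro c hc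
      rw [Set.indicator_of_notMem (s := U) (fun hcU => hc ?_), mul_zero]
      exact Subtype.ext (hU.src_inj hcU ha c.2)
  · rw [Set.indicator_of_notMem hx]
    refine (finsum_congr fun c => ?_).trans finsum_zero
    by_contra hne
    have h1 : c.1 ∈ U := Set.mem_of_indicator_ne_zero (right_ne_zero_of_mul hne)
    have h2 : 𝒢.rng c.1 ∈ K := Set.mem_of_indicator_ne_zero (left_ne_zero_of_mul hne)
    exact hx ⟨c.1, ⟨h1, h2⟩, c.2⟩

lemma conv_mem {f h : 𝒢.Arr → ℤ} (hf : f ∈ ZFun 𝒢.Arr) (hh : h ∈ ZFun 𝒢.Arr) :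
    𝒢.conv f h ∈ ZFun 𝒢.Arr := by
  rw [ZFun_arr_eq] at hf hh
  refine pairing_mem 𝒢.finOn_conv ?_ hf hh
  rintro _ ⟨U, hU, rfl⟩ _ ⟨V, hV, rfl⟩
  rw [← conv_eq_pairing, conv_indicator hU]
  exact (hU.setMul hV).mem_ZFun

lemma leftAct_mem {f : 𝒢.Arr → ℤ} {h : 𝒢.Obj → ℤ} (hf : f ∈ ZFun 𝒢.Arr)
    (hh : h ∈ ZFun 𝒢.Obj) : 𝒢.leftAct f h ∈ ZFun 𝒢.Obj := by
  rw [ZFun_arr_eq] at hf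
  rw [ZFun_obj_eq] at hh
  refine pairing_mem 𝒢.finOn_rng ?_ hf hh
  rintro _ ⟨U, hU, rfl⟩ _ ⟨K, hKo, hKc, rfl⟩
  rw [← leftAct_eq_pairing, leftAct_indicator hU]
  exact AddSubgroup.subset_closure ⟨_, isOpen_setLeft hU.isOpen hKo,
    isCompact_setLeft hU.isCompact hKc, inferInstance, rfl⟩

lemma rightAct_mem {f : 𝒢.Arr → ℤ} {h : 𝒢.Obj → ℤ} (hh : h ∈ ZFun 𝒢.Obj)
    (hf : f ∈ ZFun 𝒢.Arr) : 𝒢.rightAct h f ∈ ZFun 𝒢.Obj := by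
  rw [ZFun_arr_eq] at hf
  rw [ZFun_obj_eq] at hh
  rw [rightAct_eq_pairing]
  refine pairing_mem 𝒢.finOn_src ?_ hf hh
  rintro _ ⟨U, hU, rfl⟩ _ ⟨K, hKo, hKc, rfl⟩
  rw [← rightAct_eq_pairing, rightAct_indicator hU]
  exact AddSubgroup.subset_closure ⟨_, isOpen_setRight hKo hU.isOpen,
    isCompact_setRight hKc hU.isCompact, inferInstance, rfl⟩

variable (𝒢)

/-- The underlying additive group `ℤ𝒢` of the groupoid ring. -/
def ZRing : Type u := ZFun 𝒢.Arr

/-- The additive group `ℤ𝒢⁰` underlying the trivial left and right `ℤ𝒢`-modules. -/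
def TrivMod : Type u := ZFun 𝒢.Obj

instance : AddCommGroup 𝒢.ZRing := inferInstanceAs (AddCommGroup (ZFun 𝒢.Arr))

instance : AddCommGroup 𝒢.TrivMod := inferInstanceAs (AddCommGroup (ZFun 𝒢.Obj))

variable {𝒢}

@[ext] lemma ZRing.ext {f h : 𝒢.ZRing} (e : f.1 = h.1) : f = h := Subtype.ext e

@[ext] lemma TrivMod.ext {f h : 𝒢.TrivMod} (e : f.1 = h.1) : f = h := Subtype.ext e

instance : Mul 𝒢.ZRing := ⟨fun f h => ⟨𝒢.conv f.1 h.1, conv_mem f.2 h.2⟩⟩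

lemma ZRing.finOn_rng (f : 𝒢.ZRing) :
    FinOn (I := fun x : 𝒢.Obj => {g : 𝒢.Arr // 𝒢.rng g = x}) (fun _ a => a.1) f.1 :=
  finOn_of_mem 𝒢.finOn_rng (𝒢.ZFun_arr_eq ▸ f.2)

lemma ZRing.finOn_conv (f : 𝒢.ZRing) :
    FinOn (I := fun g : 𝒢.Arr => {a : 𝒢.Arr // 𝒢.rng a = 𝒢.rng g}) (fun _ a => a.1) f.1 :=
  finOn_of_mem 𝒢.finOn_conv (𝒢.ZFun_arr_eq ▸ f.2)

lemma ZRing.finOn_src (f : 𝒢.ZRing) :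
    FinOn (I := fun x : 𝒢.Obj => {g : 𝒢.Arr // 𝒢.src g = x}) (fun _ a => a.1) f.1 :=
  finOn_of_mem 𝒢.finOn_src (𝒢.ZFun_arr_eq ▸ f.2)

/-- The characteristic function of a compact bisection, as an element of `ℤ𝒢`. -/
def ZRing.ind {U : Set 𝒢.Arr} (hU : 𝒢.IsBisection U) : 𝒢.ZRing := ⟨U.indicator 1, hU.mem_ZFun⟩

lemma ZRing.induction {P : 𝒢.ZRing → Prop} (ind : ∀ (U) (hU : 𝒢.IsBisection U), P (ZRing.ind hU))
    (zero : P 0) (add : ∀ f h, P f → P h → P (f + h)) (neg : ∀ f, P f → P (-f))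
    (f : 𝒢.ZRing) : P f := by
  obtain ⟨f, hf⟩ := f
  have hf' := hf
  rw [ZFun_arr_eq] at hf'
  induction hf' using AddSubgroup.closure_induction with
  | mem f h =>
    obtain ⟨U, hU, rfl⟩ := h
    exact ind U hU
  | zero => exact zero
  | add f h hf' hh' ihf ihh =>
    rw [← ZFun_arr_eq] at hf' hh'
    exact add _ _ (ihf hf') (ihh hh')
  | neg f hf' ihf =>
    rw [← ZFun_arr_eq] at hf'
    exact neg _ (ihf hf')

lemma TrivMod.induction {P : 𝒢.TrivMod → Prop}
    (ind : ∀ (K) (hKo : IsOpen K) (hKc : IsCompact K), P ⟨K.indicator 1,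
      AddSubgroup.subset_closure ⟨K, hKo, hKc, inferInstance, rfl⟩⟩)
    (zero : P 0) (add : ∀ f h, P f → P h → P (f + h)) (neg : ∀ f, P f → P (-f))
    (f : 𝒢.TrivMod) : P f := by
  obtain ⟨f, hf⟩ := f
  have hf' := hf
  rw [ZFun_obj_eq] at hf'
  induction hf' using AddSubgroup.closure_induction with
  | mem f h =>
    obtain ⟨U, hU, hU', rfl⟩ := h
    exact ind U hU hU'
  | zero => exact zero
  | add f h hf' hh' ihf ihh =>
    rw [← ZFun_obj_eq] at hf' hh'
    exact add _ _ (ihf hf') (ihh hh')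
  | neg f hf' ihf =>
    rw [← ZFun_obj_eq] at hf'
    exact neg _ (ihf hf')

lemma setMul_assoc (U V W : Set 𝒢.Arr) :
    𝒢.setMul (𝒢.setMul U V) W = 𝒢.setMul U (𝒢.setMul V W) := by
  ext g
  constructor
  · rintro ⟨_, ⟨a, ha, b, hb, h, rfl⟩, c, hc, h', rfl⟩
    rw [𝒢.src_mul] at h'
    exact ⟨a, ha, _, ⟨b, hb, c, hc, h', rfl⟩, _, (𝒢.mul_assoc a b c h h').symm⟩
  · rintro ⟨a, ha, _, ⟨b, hb, c, hc, h', rfl⟩, h, rfl⟩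
    rw [𝒢.rng_mul] at h
    exact ⟨_, ⟨a, ha, b, hb, h, rfl⟩, c, hc, _, 𝒢.mul_assoc a b c h h'⟩

lemma setLeft_setMul (U V : Set 𝒢.Arr) (K : Set 𝒢.Obj) :
    𝒢.setLeft (𝒢.setMul U V) K = 𝒢.setLeft U (𝒢.setLeft V K) := by
  ext x
  constructor
  · rintro ⟨_, ⟨⟨a, ha, b, hb, h, rfl⟩, hK⟩, rfl⟩
    rw [Set.mem_preimage, 𝒢.src_mul] at hK
    exact ⟨a, ⟨ha, b, ⟨hb, hK⟩, h.symm⟩, (𝒢.rng_mul a b h).symm⟩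
  · rintro ⟨a, ⟨ha, b, ⟨hb, hK⟩, h⟩, rfl⟩
    exact ⟨_, ⟨⟨a, ha, b, hb, h.symm, rfl⟩, by rwa [Set.mem_preimage, 𝒢.src_mul]⟩,
      𝒢.rng_mul a b _⟩

lemma setRight_setMul (U V : Set 𝒢.Arr) (K : Set 𝒢.Obj) :
    𝒢.setRight K (𝒢.setMul U V) = 𝒢.setRight (𝒢.setRight K U) V := by
  ext x
  constructor
  · rintro ⟨_, ⟨⟨a, ha, b, hb, h, rfl⟩, hK⟩, rfl⟩
    rw [Set.mem_preimage, 𝒢.rng_mul] at hK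
    exact ⟨b, ⟨hb, a, ⟨ha, hK⟩, h⟩, (𝒢.src_mul a b h).symm⟩
  · rintro ⟨b, ⟨hb, a, ⟨ha, hK⟩, h⟩, rfl⟩
    exact ⟨_, ⟨⟨a, ha, b, hb, h, rfl⟩, by rwa [Set.mem_preimage, 𝒢.rng_mul]⟩,
      𝒢.src_mul a b _⟩

lemma ZRing.ind_mul_ind {U V : Set 𝒢.Arr} (hU : 𝒢.IsBisection U) (hV : 𝒢.IsBisection V) :
    ZRing.ind hU * ZRing.ind hV = ZRing.ind (hU.setMul hV) :=
  ZRing.ext (conv_indicator hU)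

protected lemma ZRing.add_mul (f f' h : 𝒢.ZRing) : (f + f') * h = f * h + f' * h :=
  ZRing.ext (pairing_add_left f.finOn_conv f'.finOn_conv h.1)

protected lemma ZRing.mul_add (f h h' : 𝒢.ZRing) : f * (h + h') = f * h + f * h' :=
  ZRing.ext (pairing_add_right f.finOn_conv h.1 h'.1)

protected lemma ZRing.neg_mul (f h : 𝒢.ZRing) : (-f) * h = -(f * h) :=
  ZRing.ext (pairing_neg_left f.1 h.1)

protected lemma ZRing.mul_neg (f h : 𝒢.ZRing) : f * (-h) = -(f * h) :=
  ZRing.ext (pairing_neg_right f.1 h.1)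

protected lemma ZRing.zero_mul (h : 𝒢.ZRing) : 0 * h = 0 := ZRing.ext (pairing_zero_left h.1)

protected lemma ZRing.mul_zero (h : 𝒢.ZRing) : h * 0 = 0 := ZRing.ext (pairing_zero_right h.1)

protected lemma ZRing.mul_assoc (f h k : 𝒢.ZRing) : f * h * k = f * (h * k) := by
  induction f using ZRing.induction with
  | zero => simp only [ZRing.zero_mul]
  | add f f' hf hf' => simp only [ZRing.add_mul, hf, hf']
  | neg f hf => simp only [ZRing.neg_mul, hf]
  | ind U hU =>
  induction h using ZRing.induction with
  | zero => simp only [ZRing.zero_mul, ZRing.mul_zero]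
  | add f f' hf hf' => simp only [ZRing.add_mul, ZRing.mul_add, hf, hf']
  | neg f hf => simp only [ZRing.neg_mul, ZRing.mul_neg, hf]
  | ind V hV =>
  induction k using ZRing.induction with
  | zero => simp only [ZRing.mul_zero]
  | add f f' hf hf' => simp only [ZRing.mul_add, hf, hf']
  | neg f hf => simp only [ZRing.mul_neg, hf]
  | ind W hW =>
    simp only [ZRing.ind_mul_ind]
    exact ZRing.ext (by simp only [ZRing.ind, setMul_assoc])

/-- The groupoid ring `ℤ𝒢`, with the convolution product. -/
instance : NonUnitalRing 𝒢.ZRing where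
  left_distrib := ZRing.mul_add
  right_distrib := ZRing.add_mul
  zero_mul := ZRing.zero_mul
  mul_zero := ZRing.mul_zero
  mul_assoc := ZRing.mul_assoc

lemma isBisection_image_one {K : Set 𝒢.Obj} (hKo : IsOpen K) (hKc : IsCompact K) :
    𝒢.IsBisection (𝒢.one '' K) where
  isOpen := 𝒢.isLocalHomeomorph_one.isOpenMap K hKo
  isCompact := hKc.image 𝒢.continuous_one
  src_inj := by
    rintro _ ⟨x, _, rfl⟩ _ ⟨y, _, rfl⟩ e
    rw [𝒢.src_one, 𝒢.src_one] at e
    rw [e]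
  rng_inj := by
    rintro _ ⟨x, _, rfl⟩ _ ⟨y, _, rfl⟩ e
    rw [𝒢.rng_one, 𝒢.rng_one] at e
    rw [e]

/-- The element `1_Y` of `ℤ𝒢`, for a compact open subset `Y` of the unit space. -/
def charUnit (Y : CompactOpens 𝒢.Obj) : 𝒢.ZRing :=
  ZRing.ind (isBisection_image_one Y.isOpen Y.isCompact)

lemma conv_one_left (K : Set 𝒢.Obj) (f : 𝒢.Arr → ℤ) :
    𝒢.conv ((𝒢.one '' K).indicator 1) f = (𝒢.rng ⁻¹' K).indicator f := by
  ext g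
  unfold conv
  rw [finsum_eq_single _ ⟨𝒢.one (𝒢.rng g), 𝒢.rng_one _⟩]
  · have h1 : 𝒢.inv (𝒢.one (𝒢.rng g)) = 𝒢.one (𝒢.rng g) := by
      symm
      apply 𝒢.inv_unique ((𝒢.src_one _).trans (𝒢.rng_one _).symm)
      have := 𝒢.mul_one (𝒢.one (𝒢.rng g))
      simp only [𝒢.src_one] at this
      rw [this, 𝒢.rng_one]
    simp only [h1, 𝒢.one_mul]
    by_cases hg : 𝒢.rng g ∈ K
    · rw [Set.indicator_of_mem (Set.mem_image_of_mem _ hg), Set.indicator_of_mem (by exact hg)]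
      simp
    · rw [Set.indicator_of_notMem, Set.indicator_of_notMem (by exact hg), zero_mul]
      rintro ⟨x, hx, e⟩
      apply hg
      have := congrArg 𝒢.rng e
      rw [𝒢.rng_one, 𝒢.rng_one] at this
      rwa [← this]
  · intro c hc
    rw [Set.indicator_of_notMem, zero_mul]
    rintro ⟨x, hx, e⟩
    apply hc
    apply Subtype.ext
    have hxg : x = 𝒢.rng g := by rw [← 𝒢.rng_one x, e, c.2]
    rw [← e, hxg]

lemma conv_one_right (K : Set 𝒢.Obj) (f : 𝒢.Arr → ℤ) :
    𝒢.conv f ((𝒢.one '' K).indicator 1) = (𝒢.src ⁻¹' K).indicator f := by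
  ext g
  unfold conv
  rw [finsum_eq_single _ ⟨g, rfl⟩]
  · simp only [𝒢.inv_mul]
    by_cases hg : 𝒢.src g ∈ K
    · rw [Set.indicator_of_mem (Set.mem_image_of_mem _ hg), Set.indicator_of_mem (by exact hg)]
      simp
    · rw [Set.indicator_of_notMem, Set.indicator_of_notMem (by exact hg), mul_zero]
      rintro ⟨x, hx, e⟩
      apply hg
      have := congrArg 𝒢.rng e
      rw [𝒢.rng_one, 𝒢.rng_one] at this
      rwa [← this]
  · intro c hc
    rw [Set.indicator_of_notMem, mul_zero]
    rintro ⟨x, hx, e⟩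
    apply hc
    apply Subtype.ext
    change c.1 = g
    have h1 := 𝒢.mul_inv_cancel_left c.1 g c.2
    have h2 := 𝒢.mul_one c.1
    have h3 : x = 𝒢.src c.1 := by
      have := congrArg 𝒢.rng e
      rwa [𝒢.rng_one, 𝒢.rng_mul, 𝒢.rng_inv] at this
    subst h3
    simp only [← e] at h1
    exact h2.symm.trans h1

/-- If the unit space is compact, then `ℤ𝒢` is a unital ring with identity `1_{𝒢⁰}`. -/
instance [CompactSpace 𝒢.Obj] : Ring 𝒢.ZRing :=
  { (inferInstance : NonUnitalRing 𝒢.ZRing) with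
    one := charUnit ⊤
    one_mul := fun f => ZRing.ext <| (conv_one_left Set.univ f.1).trans (by simp)
    mul_one := fun f => ZRing.ext <| (conv_one_right Set.univ f.1).trans (by simp) }

instance : SMul 𝒢.ZRing 𝒢.TrivMod := ⟨fun f h => ⟨𝒢.leftAct f.1 h.1, leftAct_mem f.2 h.2⟩⟩

instance : SMul 𝒢.ZRingᵐᵒᵖ 𝒢.TrivMod :=
  ⟨fun f h => ⟨𝒢.rightAct h.1 f.unop.1, rightAct_mem h.2 f.unop.2⟩⟩

namespace TrivMod

lemma left_add (f : 𝒢.ZRing) (h h' : 𝒢.TrivMod) : f • (h + h') = f • h + f • h' :=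
  TrivMod.ext (pairing_add_right f.finOn_rng h.1 h'.1)

lemma left_neg (f : 𝒢.ZRing) (h : 𝒢.TrivMod) : f • (-h) = -(f • h) :=
  TrivMod.ext (pairing_neg_right f.1 h.1)

lemma left_zero (f : 𝒢.ZRing) : f • (0 : 𝒢.TrivMod) = 0 :=
  TrivMod.ext (pairing_zero_right f.1)

lemma add_left (f f' : 𝒢.ZRing) (h : 𝒢.TrivMod) : (f + f') • h = f • h + f' • h :=
  TrivMod.ext (pairing_add_left f.finOn_rng f'.finOn_rng h.1)

lemma neg_left (f : 𝒢.ZRing) (h : 𝒢.TrivMod) : (-f) • h = -(f • h) :=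
  TrivMod.ext (pairing_neg_left f.1 h.1)

lemma zero_left (h : 𝒢.TrivMod) : (0 : 𝒢.ZRing) • h = 0 :=
  TrivMod.ext (pairing_zero_left h.1)

lemma right_add (f : 𝒢.ZRing) (h h' : 𝒢.TrivMod) :
    MulOpposite.op f • (h + h') = MulOpposite.op f • h + MulOpposite.op f • h' :=
  TrivMod.ext <| by
    change 𝒢.rightAct (h.1 + h'.1) f.1 = 𝒢.rightAct h.1 f.1 + 𝒢.rightAct h'.1 f.1
    simp only [rightAct_eq_pairing]
    exact pairing_add_right f.finOn_src h.1 h'.1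

lemma right_neg (f : 𝒢.ZRing) (h : 𝒢.TrivMod) :
    MulOpposite.op f • (-h) = -(MulOpposite.op f • h) :=
  TrivMod.ext <| by
    change 𝒢.rightAct (-h.1) f.1 = -𝒢.rightAct h.1 f.1
    simp only [rightAct_eq_pairing]
    exact pairing_neg_right f.1 h.1

lemma right_zero (f : 𝒢.ZRing) : MulOpposite.op f • (0 : 𝒢.TrivMod) = 0 :=
  TrivMod.ext <| by
    change 𝒢.rightAct 0 f.1 = 0
    simp only [rightAct_eq_pairing]
    exact pairing_zero_right f.1

lemma add_right (f f' : 𝒢.ZRing) (h : 𝒢.TrivMod) :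
    MulOpposite.op (f + f') • h = MulOpposite.op f • h + MulOpposite.op f' • h :=
  TrivMod.ext <| by
    change 𝒢.rightAct h.1 (f.1 + f'.1) = 𝒢.rightAct h.1 f.1 + 𝒢.rightAct h.1 f'.1
    simp only [rightAct_eq_pairing]
    exact pairing_add_left f.finOn_src f'.finOn_src h.1

lemma neg_right (f : 𝒢.ZRing) (h : 𝒢.TrivMod) :
    MulOpposite.op (-f) • h = -(MulOpposite.op f • h) :=
  TrivMod.ext <| by
    change 𝒢.rightAct h.1 (-f.1) = -𝒢.rightAct h.1 f.1
    simp only [rightAct_eq_pairing]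
    exact pairing_neg_left f.1 h.1

lemma zero_right (h : 𝒢.TrivMod) : MulOpposite.op (0 : 𝒢.ZRing) • h = 0 :=
  TrivMod.ext <| by
    change 𝒢.rightAct h.1 0 = 0
    simp only [rightAct_eq_pairing]
    exact pairing_zero_left h.1

protected lemma mul_left (f h : 𝒢.ZRing) (k : 𝒢.TrivMod) : (f * h) • k = f • h • k := by
  induction f using ZRing.induction with
  | zero => simp only [zero_mul, zero_left]
  | add f f' hf hf' => simp only [add_mul, add_left, hf, hf']
  | neg f hf => simp only [neg_mul, neg_left, hf]
  | ind U hU =>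
  induction h using ZRing.induction with
  | zero => simp only [mul_zero, zero_left, left_zero]
  | add f f' hf hf' => simp only [mul_add, add_left, left_add, hf, hf']
  | neg f hf => simp only [mul_neg, neg_left, left_neg, hf]
  | ind V hV =>
  induction k using TrivMod.induction with
  | zero => simp only [left_zero]
  | add f f' hf hf' => simp only [left_add, hf, hf']
  | neg f hf => simp only [left_neg, hf]
  | ind K hKo hKc =>
    rw [ZRing.ind_mul_ind]
    apply TrivMod.ext
    change 𝒢.leftAct ((𝒢.setMul U V).indicator 1) (K.indicator 1) =
      𝒢.leftAct (U.indicator 1) (𝒢.leftAct (V.indicator 1) (K.indicator 1))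
    rw [leftAct_indicator (hU.setMul hV), leftAct_indicator hV, leftAct_indicator hU,
      setLeft_setMul]

protected lemma mul_right (f h : 𝒢.ZRing) (k : 𝒢.TrivMod) :
    MulOpposite.op (f * h) • k = MulOpposite.op h • MulOpposite.op f • k := by
  induction f using ZRing.induction with
  | zero => simp only [zero_mul, zero_right, right_zero]
  | add f f' hf hf' => simp only [add_mul, add_right, right_add, hf, hf']
  | neg f hf => simp only [neg_mul, neg_right, right_neg, hf]
  | ind U hU =>
  induction h using ZRing.induction with
  | zero => simp only [mul_zero, zero_right]
  | add f f' hf hf' => simp only [mul_add, add_right, hf, hf']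
  | neg f hf => simp only [mul_neg, neg_right, hf]
  | ind V hV =>
  induction k using TrivMod.induction with
  | zero => simp only [right_zero]
  | add f f' hf hf' => simp only [right_add, hf, hf']
  | neg f hf => simp only [right_neg, hf]
  | ind K hKo hKc =>
    rw [ZRing.ind_mul_ind]
    apply TrivMod.ext
    change 𝒢.rightAct (K.indicator 1) ((𝒢.setMul U V).indicator 1) =
      𝒢.rightAct (𝒢.rightAct (K.indicator 1) (U.indicator 1)) (V.indicator 1)
    rw [rightAct_indicator (hU.setMul hV), rightAct_indicator hU, rightAct_indicator hV,
      setRight_setMul]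

end TrivMod

/-- The trivial left `ℤ𝒢`-module `ℤ𝒢⁰`. -/
instance [CompactSpace 𝒢.Obj] : Module 𝒢.ZRing 𝒢.TrivMod where
  one_smul h := TrivMod.ext <| by
    ext x
    change 𝒢.leftAct ((𝒢.one '' Set.univ).indicator 1) h.1 x = h.1 x
    unfold leftAct
    rw [finsum_eq_single _ ⟨𝒢.one x, 𝒢.rng_one x⟩]
    · simp [𝒢.src_one]
    · intro c hc
      rw [Set.indicator_of_notMem, zero_mul]
      rintro ⟨y, _, e⟩
      apply hc
      apply Subtype.ext
      have hyx : y = x := by rw [← 𝒢.rng_one y, e, c.2]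
      rw [← e, hyx]
  mul_smul := TrivMod.mul_left
  smul_zero := TrivMod.left_zero
  smul_add := TrivMod.left_add
  add_smul := TrivMod.add_left
  zero_smul := TrivMod.zero_left

/-- The trivial right `ℤ𝒢`-module `ℤ𝒢⁰`. -/
instance [CompactSpace 𝒢.Obj] : Module 𝒢.ZRingᵐᵒᵖ 𝒢.TrivMod where
  one_smul h := TrivMod.ext <| by
    ext x
    change 𝒢.rightAct h.1 ((𝒢.one '' Set.univ).indicator 1) x = h.1 x
    unfold rightAct
    rw [finsum_eq_single _ ⟨𝒢.one x, 𝒢.src_one x⟩]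
    · simp [𝒢.rng_one]
    · intro c hc
      rw [Set.indicator_of_notMem (s := 𝒢.one '' Set.univ), mul_zero]
      rintro ⟨y, _, e⟩
      apply hc
      apply Subtype.ext
      have hyx : y = x := by rw [← 𝒢.src_one y, e, c.2]
      rw [← e, hyx]
  mul_smul f h k := TrivMod.mul_right h.unop f.unop k
  smul_zero f := TrivMod.right_zero f.unop
  smul_add f := TrivMod.right_add f.unop
  add_smul f h := TrivMod.add_right f.unop h.unop
  zero_smul := TrivMod.zero_right

/-! #### Homology -/

variable (𝒢)

/-- The homology `H_n(𝒢, M) = Tor_n^{ℤ𝒢}(ℤ𝒢⁰, M)` of an ample groupoid with compact unit space,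
with coefficients in a left `ℤ𝒢`-module `M`. -/
def homology [CompactSpace 𝒢.Obj] (n : ℕ) (M : Type v) [AddCommGroup M] [Module 𝒢.ZRing M] :
    AddCommGrpCat.{max u v} :=
  Balanced.Tor 𝒢.ZRing n 𝒢.TrivMod M

/-- The homology `H_n(𝒢) = H_n(𝒢, ℤ𝒢⁰)`. -/
def integralHomology [CompactSpace 𝒢.Obj] (n : ℕ) : AddCommGrpCat.{u} :=
  𝒢.homology n 𝒢.TrivMod

/-! #### Reductions -/

/-- A set of units is full if it meets every orbit. -/
def IsFull (Y : Set 𝒢.Obj) : Prop := ∀ x, ∃ g, 𝒢.src g ∈ Y ∧ 𝒢.rng g = x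

/-- The set `𝒢^Y_Y` of arrows with source and range in `Y`. -/
def reductionArr (Y : Set 𝒢.Obj) : Set 𝒢.Arr := {g | 𝒢.rng g ∈ Y ∧ 𝒢.src g ∈ Y}

variable {𝒢} in
lemma isOpen_reductionArr {Y : Set 𝒢.Obj} (hY : IsOpen Y) : IsOpen (𝒢.reductionArr Y) :=
  (hY.preimage 𝒢.continuous_rng).inter (hY.preimage 𝒢.continuous_src)

/-- The groupoid `𝒢^Y_Y` with unit space `Y`, with the subspace topologies. -/
def reduction (Y : CompactOpens 𝒢.Obj) : AmpleGroupoid.{u} where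
  Obj := (Y : Set 𝒢.Obj)
  Arr := 𝒢.reductionArr Y
  src g := ⟨𝒢.src g.1, g.2.2⟩
  rng g := ⟨𝒢.rng g.1, g.2.1⟩
  one x := ⟨𝒢.one x.1, by rw [𝒢.rng_one]; exact x.2, by rw [𝒢.src_one]; exact x.2⟩
  mul a b h := ⟨𝒢.mul a.1 b.1 (congrArg Subtype.val h),
    by rw [𝒢.rng_mul]; exact a.2.1, by rw [𝒢.src_mul]; exact b.2.2⟩
  inv a := ⟨𝒢.inv a.1, by rw [𝒢.rng_inv]; exact a.2.2, by rw [𝒢.src_inv]; exact a.2.1⟩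
  src_one x := Subtype.ext (𝒢.src_one x.1)
  rng_one x := Subtype.ext (𝒢.rng_one x.1)
  src_mul _ _ _ := Subtype.ext (𝒢.src_mul _ _ _)
  rng_mul _ _ _ := Subtype.ext (𝒢.rng_mul _ _ _)
  src_inv _ := Subtype.ext (𝒢.src_inv _)
  rng_inv _ := Subtype.ext (𝒢.rng_inv _)
  one_mul _ := Subtype.ext (𝒢.one_mul _)
  mul_one _ := Subtype.ext (𝒢.mul_one _)
  inv_mul _ := Subtype.ext (𝒢.inv_mul _)
  mul_inv _ := Subtype.ext (𝒢.mul_inv _)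
  mul_assoc _ _ _ _ _ := Subtype.ext (𝒢.mul_assoc _ _ _ _ _)
  continuous_rng := (𝒢.continuous_rng.comp continuous_subtype_val).subtype_mk _
  continuous_one := (𝒢.continuous_one.comp continuous_subtype_val).subtype_mk _
  continuous_mul := by
    refine Continuous.subtype_mk (𝒢.continuous_mul.comp
      (Continuous.subtype_mk (f := fun p : {p : 𝒢.reductionArr Y × 𝒢.reductionArr Y //
        (⟨𝒢.src p.1.1, p.1.2.2⟩ : (Y : Set 𝒢.Obj)) = ⟨𝒢.rng p.2.1, p.2.2.1⟩} =>
        (p.1.1.1, p.1.2.1)) ?_ fun p => congrArg Subtype.val p.2)) _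
    fun_prop
  continuous_inv := (𝒢.continuous_inv.comp continuous_subtype_val).subtype_mk _
  locallyCompact := Y.isOpen.isOpenEmbedding_subtypeVal.locallyCompactSpace
  isLocalHomeomorph_src := by
    refine IsLocalHomeomorph.of_comp (g := Subtype.val) ?_
      Y.isOpen.isOpenEmbedding_subtypeVal.isLocalHomeomorph
      ((𝒢.continuous_src.comp continuous_subtype_val).subtype_mk _)
    exact 𝒢.isLocalHomeomorph_src.comp
      (isOpen_reductionArr Y.isOpen).isOpenEmbedding_subtypeVal.isLocalHomeomorph

variable (Y : CompactOpens 𝒢.Obj)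

instance : CompactSpace (𝒢.reduction Y).Obj := isCompact_iff_compactSpace.1 Y.isCompact

variable {𝒢 Y}

/-- The inclusion of the arrows of `𝒢^Y_Y` into those of `𝒢`. -/
def inclArr (g : (𝒢.reduction Y).Arr) : 𝒢.Arr :=
  Subtype.val (p := fun g => g ∈ 𝒢.reductionArr Y) g

lemma inclArr_injective : Function.Injective (inclArr (𝒢 := 𝒢) (Y := Y)) :=
  Subtype.val_injective

/-- Extension by zero of functions on `𝒢^Y_Y`. -/
def extendZero (f : (𝒢.reduction Y).Arr → ℤ) : 𝒢.Arr → ℤ :=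
  Function.extend inclArr f 0

lemma extendZero_indicator (U : Set (𝒢.reduction Y).Arr) :
    extendZero (U.indicator 1) =
      (inclArr '' U).indicator 1 := by
  ext g
  unfold extendZero
  by_cases hg : ∃ g', inclArr (𝒢 := 𝒢) (Y := Y) g' = g
  · obtain ⟨g, rfl⟩ := hg
    rw [inclArr_injective.extend_apply]
    by_cases h : g ∈ U
    · rw [Set.indicator_of_mem h, Set.indicator_of_mem (Set.mem_image_of_mem _ h)]
      rfl
    · rw [Set.indicator_of_notMem h, Set.indicator_of_notMem]
      rwa [inclArr_injective.mem_set_image]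
  · rw [Function.extend_apply' _ _ _ hg, Set.indicator_of_notMem]
    · rfl
    · rintro ⟨g', _, e⟩
      exact hg ⟨g', e⟩

lemma IsBisection.image_val {U : Set (𝒢.reduction Y).Arr} (hU : (𝒢.reduction Y).IsBisection U) :
    𝒢.IsBisection (inclArr '' U) where
  isOpen := (isOpen_reductionArr Y.isOpen).isOpenMap_subtype_val U hU.isOpen
  isCompact := hU.isCompact.image continuous_subtype_val
  src_inj := by
    rintro _ ⟨a, ha, rfl⟩ _ ⟨b, hb, rfl⟩ e
    exact congrArg inclArr (hU.src_inj ha hb (Subtype.ext e))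
  rng_inj := by
    rintro _ ⟨a, ha, rfl⟩ _ ⟨b, hb, rfl⟩ e
    exact congrArg inclArr (hU.rng_inj ha hb (Subtype.ext e))

lemma extendZero_add (f h : (𝒢.reduction Y).Arr → ℤ) :
    extendZero (f + h) = extendZero f + extendZero h := by
  have := Function.extend_add (inclArr (𝒢 := 𝒢) (Y := Y)) f h 0 0
  rwa [add_zero] at this

lemma extendZero_neg (f : (𝒢.reduction Y).Arr → ℤ) :
    extendZero (-f) = -extendZero f := by
  have := Function.extend_neg (inclArr (𝒢 := 𝒢) (Y := Y)) f 0
  rwa [neg_zero] at this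

lemma extendZero_zero : extendZero (0 : (𝒢.reduction Y).Arr → ℤ) = 0 :=
  Function.extend_zero _

lemma extendZero_mem (f : (𝒢.reduction Y).ZRing) : extendZero f.1 ∈ ZFun 𝒢.Arr := by
  induction f using ZRing.induction with
  | ind U hU =>
    change extendZero (U.indicator 1) ∈ _
    rw [extendZero_indicator]
    exact hU.image_val.mem_ZFun
  | zero =>
    change extendZero (0 : (𝒢.reduction Y).Arr → ℤ) ∈ _
    rw [extendZero_zero]
    exact AddSubgroup.zero_mem _
  | add f h hf hh =>
    change extendZero (f.1 + h.1) ∈ _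
    rw [extendZero_add]
    exact AddSubgroup.add_mem _ hf hh
  | neg f hf =>
    change extendZero (-f.1) ∈ _
    rw [extendZero_neg]
    exact AddSubgroup.neg_mem _ hf

variable (Y) in
/-- The embedding `ℤ𝒢^Y_Y → ℤ𝒢`, by extension by zero. -/
def incl : (𝒢.reduction Y).ZRing →+ 𝒢.ZRing where
  toFun f := ⟨extendZero f.1, extendZero_mem f⟩
  map_zero' := ZRing.ext extendZero_zero
  map_add' f h := ZRing.ext (extendZero_add f.1 h.1)

lemma incl_ind {U : Set (𝒢.reduction Y).Arr} (hU : (𝒢.reduction Y).IsBisection U) :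
    incl Y (ZRing.ind hU) = ZRing.ind hU.image_val :=
  ZRing.ext (extendZero_indicator U)

lemma image_setMul (U V : Set (𝒢.reduction Y).Arr) :
    inclArr '' (𝒢.reduction Y).setMul U V =
      𝒢.setMul (inclArr '' U)
        (inclArr '' V) := by
  ext g
  constructor
  · rintro ⟨_, ⟨a, ha, b, hb, h, rfl⟩, rfl⟩
    exact ⟨_, ⟨a, ha, rfl⟩, _, ⟨b, hb, rfl⟩, congrArg Subtype.val h, rfl⟩
  · rintro ⟨_, ⟨a, ha, rfl⟩, _, ⟨b, hb, rfl⟩, h, rfl⟩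
    exact ⟨_, ⟨a, ha, b, hb, Subtype.ext h, rfl⟩, rfl⟩

lemma incl_mul (f h : (𝒢.reduction Y).ZRing) : incl Y (f * h) = incl Y f * incl Y h := by
  induction f using ZRing.induction with
  | zero => simp only [map_zero, zero_mul]
  | add f f' hf hf' => simp only [map_add, add_mul, hf, hf']
  | neg f hf => simp only [map_neg, neg_mul, hf]
  | ind U hU =>
  induction h using ZRing.induction with
  | zero => simp only [map_zero, mul_zero]
  | add f f' hf hf' => simp only [map_add, mul_add, hf, hf']
  | neg f hf => simp only [map_neg, mul_neg, hf]
  | ind V hV =>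
    rw [ZRing.ind_mul_ind, incl_ind, incl_ind, incl_ind, ZRing.ind_mul_ind]
    exact ZRing.ext (by simp only [ZRing.ind, image_setMul])

lemma incl_one : incl Y 1 = charUnit Y := by
  apply ZRing.ext
  refine (extendZero_indicator ((𝒢.reduction Y).one '' Set.univ)).trans ?_
  change _ = (𝒢.one '' Y).indicator 1
  congr 1
  ext g
  constructor
  · rintro ⟨_, ⟨y, _, rfl⟩, rfl⟩
    exact ⟨y.1, y.2, rfl⟩
  · rintro ⟨y, hy, rfl⟩
    exact ⟨_, ⟨⟨y, hy⟩, trivial, rfl⟩, rfl⟩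

variable (Y)

/-- The subgroup `1_Y M = {1_Y m | m ∈ M}` of a `ℤ𝒢`-module `M`. -/
def corner [CompactSpace 𝒢.Obj] (M : Type v) [AddCommGroup M] [Module 𝒢.ZRing M] :
    AddSubgroup M :=
  (DistribSMul.toAddMonoidHom M (charUnit Y)).range

variable [CompactSpace 𝒢.Obj] {M : Type v} [AddCommGroup M] [Module 𝒢.ZRing M]

lemma incl_smul_mem (f : (𝒢.reduction Y).ZRing) (m : M) : incl Y f • m ∈ corner Y M := by
  refine ⟨incl Y f • m, ?_⟩
  change charUnit Y • incl Y f • m = incl Y f • m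
  rw [← incl_one, ← mul_smul, ← incl_mul, _root_.one_mul]

lemma charUnit_smul_of_mem {m : M} (hm : m ∈ corner Y M) : charUnit Y • m = m := by
  obtain ⟨m, rfl⟩ := hm
  change charUnit Y • charUnit Y • m = charUnit Y • m
  rw [← incl_one, ← mul_smul, ← incl_mul, _root_.one_mul]

/-- The `ℤ𝒢^Y_Y`-module `1_Y M`: elements of `ℤ𝒢^Y_Y` act on it as elements of `ℤ𝒢`. -/
instance : Module (𝒢.reduction Y).ZRing (corner Y M) where
  smul f m := ⟨incl Y f • m.1, incl_smul_mem Y f m.1⟩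
  one_smul m := Subtype.ext <| by
    change incl Y 1 • m.1 = m.1
    rw [incl_one, charUnit_smul_of_mem Y m.2]
  mul_smul f h m := Subtype.ext <| by
    change incl Y (f * h) • m.1 = incl Y f • incl Y h • m.1
    rw [incl_mul, mul_smul]
  smul_zero f := Subtype.ext (smul_zero (incl Y f))
  smul_add f m m' := Subtype.ext (smul_add (incl Y f) m.1 m'.1)
  add_smul f h m := Subtype.ext <| by
    change incl Y (f + h) • m.1 = incl Y f • m.1 + incl Y h • m.1
    rw [map_add, add_smul]
  zero_smul m := Subtype.ext <| by
    change incl Y 0 • m.1 = 0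
    rw [map_zero, zero_smul]

end AmpleGroupoid

end

noncomputable section

/-! ### Balanced tensor products -/

namespace Balanced

variable {A : Type u} [Ring A] {N : Type w} [AddCommGroup N] [Module Aᵐᵒᵖ N]
  {M : Type v} [AddCommGroup M] [Module A M] {P : Type*} [AddCommGroup P]

lemma Tensor.smul_tmul (n : N) (a : A) (m : M) :
    Tensor.tmul A (MulOpposite.op a • n) m = Tensor.tmul A n (a • m) := by
  refine (QuotientAddGroup.eq_iff_sub_mem).2 (AddSubgroup.subset_closure ⟨n, a, m, rfl⟩)

lemma Tensor.add_tmul (n n' : N) (m : M) :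
    Tensor.tmul A (n + n') m = Tensor.tmul A n m + Tensor.tmul A n' m :=
  congrArg (QuotientAddGroup.mk (s := relations A N M)) (TensorProduct.add_tmul n n' m)

lemma Tensor.tmul_add (n : N) (m m' : M) :
    Tensor.tmul A n (m + m') = Tensor.tmul A n m + Tensor.tmul A n m' :=
  congrArg (QuotientAddGroup.mk (s := relations A N M)) (TensorProduct.tmul_add n m m')

variable (A N M) in
/-- The biadditive map `(n, m) ↦ n ⊗ m`. -/
def Tensor.mk : N →+ M →+ Tensor A N M :=
  AddMonoidHom.mk' (fun n => AddMonoidHom.mk' (Tensor.tmul A n) (Tensor.tmul_add n))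
    fun n n' => AddMonoidHom.ext fun m => Tensor.add_tmul n n' m

lemma Tensor.sum_tmul {ι : Type*} (s : Finset ι) (f : ι → N) (m : M) :
    Tensor.tmul A (∑ i ∈ s, f i) m = ∑ i ∈ s, Tensor.tmul A (f i) m := by
  change Tensor.mk A N M _ m = ∑ i ∈ s, Tensor.mk A N M (f i) m
  rw [map_sum, AddMonoidHom.finsetSum_apply]

lemma Tensor.tmul_sum {ι : Type*} (s : Finset ι) (n : N) (f : ι → M) :
    Tensor.tmul A n (∑ i ∈ s, f i) = ∑ i ∈ s, Tensor.tmul A n (f i) :=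
  map_sum (Tensor.mk A N M n) f s

/-- The homomorphism out of `N ⊗_A M` given by a balanced biadditive map. -/
def Tensor.lift (f : N →+ M →+ P)
    (hf : ∀ n (a : A) m, f (MulOpposite.op a • n) m = f n (a • m)) : Tensor A N M →+ P :=
  QuotientAddGroup.lift _ (TensorProduct.liftAddHom f fun r n m => by simp) <| by
    refine (AddSubgroup.closure_le _).2 ?_
    rintro _ ⟨n, a, m, rfl⟩
    simp [AddMonoidHom.mem_ker, hf]

lemma Tensor.lift_tmul (f : N →+ M →+ P)
    (hf : ∀ n (a : A) m, f (MulOpposite.op a • n) m = f n (a • m)) (n : N) (m : M) :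
    Tensor.lift f hf (Tensor.tmul A n m) = f n m := rfl

end Balanced

/-! ### Full corners -/

/-- A presentation of the ring `B` as a full corner `eAe` of `A`: an isomorphism `incl` of `B`
onto `eAe`, where `e = incl 1`, with inverse induced by `proj`, and an expression of `1` as an
element of `AeA`. -/
structure FullCorner (A B : Type*) [Ring A] [Ring B] where
  incl : B →ₙ+* A
  incl_injective : Function.Injective incl
  proj : A →+ B
  incl_proj : ∀ a, incl (proj a) = incl 1 * a * incl 1
  size : ℕ
  left : Fin size → A
  right : Fin size → A
  sum_eq_one : ∑ i, left i * incl 1 * right i = 1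

namespace FullCorner

open MulOpposite Balanced

variable {A B : Type*} [Ring A] [Ring B] (c : FullCorner A B)

lemma incl_one_mul (b : B) : c.incl 1 * c.incl b = c.incl b := by rw [← map_mul, one_mul]

lemma incl_mul_one (b : B) : c.incl b * c.incl 1 = c.incl b := by rw [← map_mul, mul_one]

lemma proj_mul_incl (a : A) (b : B) : c.proj (a * c.incl b) = c.proj a * b := by
  apply c.incl_injective
  rw [map_mul c.incl, incl_proj, incl_proj]
  simp only [mul_assoc, c.incl_mul_one, c.incl_one_mul]

section RightCorner

variable (N : Type w) [AddCommGroup N] [Module Aᵐᵒᵖ N]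

/-- The subgroup `Ne` of a right `A`-module `N`. -/
def rightCorner : AddSubgroup N where
  carrier := {n | op (c.incl 1) • n = n}
  zero_mem' := smul_zero _
  add_mem' {n n'} (hn : _ = _) (hn' : _ = _) := by
    change _ = _
    rw [smul_add, hn, hn']
  neg_mem' {n} (hn : _ = _) := by
    change _ = _
    rw [smul_neg, hn]

variable {N} in
lemma smul_of_mem {n : N} (hn : n ∈ c.rightCorner N) : op (c.incl 1) • n = n := hn

variable {N} in
lemma smul_mem {a : A} (ha : a * c.incl 1 = a) (n : N) : op a • n ∈ c.rightCorner N := by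
  change op (c.incl 1) • op a • n = op a • n
  rw [← mul_smul, ← op_mul, ha]

instance : Module Bᵐᵒᵖ (c.rightCorner N) where
  smul b n := ⟨op (c.incl b.unop) • n.1, c.smul_mem (c.incl_mul_one _) n.1⟩
  one_smul n := Subtype.ext n.2
  mul_smul b b' n := Subtype.ext <| by
    change op (c.incl (b'.unop * b.unop)) • n.1 = _
    rw [map_mul, op_mul, mul_smul]
    rfl
  smul_zero b := Subtype.ext (smul_zero _)
  smul_add b n n' := Subtype.ext (smul_add _ _ _)
  add_smul b b' n := Subtype.ext <| by
    change op (c.incl (b.unop + b'.unop)) • n.1 = _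
    rw [map_add, MulOpposite.op_add, add_smul]
    rfl
  zero_smul n := Subtype.ext <| by
    change op (c.incl 0) • n.1 = 0
    rw [map_zero, op_zero, zero_smul]

variable {N} in
lemma coe_smul (b : Bᵐᵒᵖ) (n : c.rightCorner N) :
    ((b • n : c.rightCorner N) : N) = op (c.incl b.unop) • (n : N) := rfl

variable {N} in
/-- Multiplication by an element of `Ae`. -/
def mulRight (a : A) (ha : a * c.incl 1 = a) : N →+ c.rightCorner N :=
  AddMonoidHom.mk' (fun n => ⟨op a • n, c.smul_mem ha n⟩)
    fun _ _ => Subtype.ext (smul_add _ _ _)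

end RightCorner

/-- The restriction `Ne → N'e` of a homomorphism `N → N'` of right `A`-modules. -/
def rightCornerMap {N N' : Type w} [AddCommGroup N] [Module Aᵐᵒᵖ N] [AddCommGroup N']
    [Module Aᵐᵒᵖ N'] (f : N →ₗ[Aᵐᵒᵖ] N') : c.rightCorner N →ₗ[Bᵐᵒᵖ] c.rightCorner N' where
  toFun n := ⟨f n, by
    change op (c.incl 1) • f n.1 = f n.1
    rw [← map_smul, c.smul_of_mem n.2]⟩
  map_add' _ _ := Subtype.ext (map_add f _ _)
  map_smul' _ _ := Subtype.ext (map_smul f _ _)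

/-- The element `left i * e`. -/
def leftGen (i : Fin c.size) : A := c.left i * c.incl 1

/-- The element `e * right i`. -/
def rightGen (i : Fin c.size) : A := c.incl 1 * c.right i

lemma leftGen_mul (i : Fin c.size) : c.leftGen i * c.incl 1 = c.leftGen i := by
  rw [leftGen, mul_assoc, c.incl_mul_one]

lemma mul_rightGen (i : Fin c.size) : c.incl 1 * c.rightGen i = c.rightGen i := by
  rw [rightGen, ← mul_assoc, c.incl_mul_one]

lemma sum_gen : ∑ i, c.leftGen i * c.rightGen i = 1 := by
  rw [← c.sum_eq_one]
  refine Finset.sum_congr rfl fun i _ => ?_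
  rw [leftGen, rightGen, mul_assoc, ← mul_assoc (c.incl 1), c.incl_mul_one, mul_assoc]

section Projective

variable (N : Type w) [AddCommGroup N] [Module Aᵐᵒᵖ N]

/-- `a ↦ (e * right i * a * e)ᵢ`. -/
def coords : Aᵐᵒᵖ →+ (Fin c.size → Bᵐᵒᵖ) :=
  AddMonoidHom.mk' (fun a i => op (c.proj (c.rightGen i * a.unop))) fun a a' => by
    ext i
    simp [mul_add]

/-- `n ↦ ((bᵢ) ↦ ∑ n * left i * bᵢ)`. -/
def combine (n : N) : (Fin c.size → Bᵐᵒᵖ) →ₗ[Bᵐᵒᵖ] c.rightCorner N :=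
  Fintype.linearCombination Bᵐᵒᵖ fun i => c.mulRight (c.leftGen i) (c.leftGen_mul i) n

lemma combine_coords (n : N) (a : Aᵐᵒᵖ) :
    (c.combine N n (c.coords a) : N) = op (c.incl 1) • a • n := by
  have h : ∀ i, ((c.coords a i • c.mulRight (c.leftGen i) (c.leftGen_mul i) n :
      c.rightCorner N) : N) = op (c.leftGen i * c.rightGen i * (a.unop * c.incl 1)) • n := by
    intro i
    rw [coe_smul]
    change op (c.incl (c.proj (c.rightGen i * a.unop))) • op (c.leftGen i) • n = _
    rw [← mul_smul, ← op_mul, c.incl_proj]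
    congr 2
    simp only [← mul_assoc]
    rw [c.leftGen_mul]
  rw [combine, Fintype.linearCombination_apply, AddSubgroup.val_finsetSum,
    Finset.sum_congr rfl fun i _ => h i, ← Finset.sum_smul, ← Finset.op_sum, ← Finset.sum_mul,
    c.sum_gen, one_mul, op_mul, mul_smul, op_unop]

instance rightCorner_projective [Module.Projective Aᵐᵒᵖ N] :
    Module.Projective Bᵐᵒᵖ (c.rightCorner N) := by
  obtain ⟨s, hs⟩ := Module.projective_def.1 ‹Module.Projective Aᵐᵒᵖ N›
  let σ : c.rightCorner N →ₗ[Bᵐᵒᵖ] (N →₀ (Fin c.size → Bᵐᵒᵖ)) :=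
    { toFun := fun n => (s n.1).mapRange c.coords (map_zero _)
      map_add' := fun n n' => by
        rw [AddSubgroup.coe_add, map_add, Finsupp.mapRange_add (map_add _)]
      map_smul' := fun b n => by
        ext m i
        rw [coe_smul, map_smul]
        simp only [coords, AddMonoidHom.mk'_apply, Finsupp.mapRange_apply, Finsupp.smul_apply,
          RingHom.id_apply, Pi.smul_apply, smul_eq_mul, unop_mul, unop_op]
        rw [← mul_assoc, c.proj_mul_incl, op_mul, op_unop] }
  let ρ : (N →₀ (Fin c.size → Bᵐᵒᵖ)) →ₗ[Bᵐᵒᵖ] c.rightCorner N :=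
    Finsupp.lsum ℕ (c.combine N)
  refine Module.Projective.of_split σ ρ (LinearMap.ext fun n => Subtype.ext ?_)
  change (Finsupp.lsum ℕ (c.combine N) ((s n.1).mapRange c.coords (map_zero _)) : N) = n.1
  rw [Finsupp.lsum_apply, Finsupp.sum_mapRange_index fun _ => map_zero _, Finsupp.sum,
    AddSubgroup.val_finsetSum]
  refine (Finset.sum_congr rfl fun m _ => c.combine_coords N m _).trans ?_
  rw [← Finset.smul_sum]
  conv_rhs => rw [← c.smul_of_mem n.2]
  congr 1
  exact hs n.1

end Projective

section LeftCorner

variable {A B : Type*} [Ring A] [Ring B] (c : FullCorner A B)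

/-- The homomorphism `j` identifies the `B`-module `M'` with the subgroup `eM` of `M`. -/
structure IsLeftCorner {M M' : Type*} [AddCommGroup M] [Module A M] [AddCommGroup M']
    [Module B M'] (j : M' →+ M) : Prop where
  injective : Function.Injective j
  map_smul : ∀ (b : B) m, j (b • m) = c.incl b • j m
  exists_eq : ∀ m, ∃ m', j m' = c.incl 1 • m

/-- The homomorphism `j` identifies the right `B`-module `N'` with the subgroup `Ne` of `N`. -/
structure IsRightCorner {N N' : Type*} [AddCommGroup N] [Module Aᵐᵒᵖ N] [AddCommGroup N']
    [Module Bᵐᵒᵖ N'] (j : N' →+ N) : Prop where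
  injective : Function.Injective j
  map_smul : ∀ (b : B) n, j (op b • n) = op (c.incl b) • j n
  exists_eq : ∀ n, ∃ n', j n' = op (c.incl 1) • n

variable {c}

lemma IsRightCorner.map_mem {N N' : Type*} [AddCommGroup N] [Module Aᵐᵒᵖ N] [AddCommGroup N']
    [Module Bᵐᵒᵖ N'] {j : N' →+ N} (hj : c.IsRightCorner j) (n : N') : j n ∈ c.rightCorner N := by
  change op (c.incl 1) • j n = j n
  rw [← hj.map_smul, op_one, one_smul]

/-- The isomorphism of `N'` with `Ne`. -/
def IsRightCorner.linearEquiv {N N' : Type*} [AddCommGroup N] [Module Aᵐᵒᵖ N] [AddCommGroup N']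
    [Module Bᵐᵒᵖ N'] {j : N' →+ N} (hj : c.IsRightCorner j) : N' ≃ₗ[Bᵐᵒᵖ] c.rightCorner N :=
  LinearEquiv.ofBijective
    { toFun := fun n => ⟨j n, hj.map_mem n⟩
      map_add' := fun _ _ => Subtype.ext (map_add j _ _)
      map_smul' := fun b n => Subtype.ext (hj.map_smul b.unop n) }
    ⟨fun _ _ h => hj.injective (congrArg Subtype.val h), fun n => by
      obtain ⟨n', h⟩ := hj.exists_eq n.1
      exact ⟨n', Subtype.ext (h.trans (c.smul_of_mem n.2))⟩⟩

variable {M M' : Type v} [AddCommGroup M] [Module A M] [AddCommGroup M'] [Module B M']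
  {j : M' →+ M}

lemma IsLeftCorner.smul_map (hj : c.IsLeftCorner j) (m : M') : c.incl 1 • j m = j m := by
  rw [← hj.map_smul, one_smul]

/-- The map `m ↦ em` from `M` to `M' = eM`. -/
def IsLeftCorner.proj (hj : c.IsLeftCorner j) : M →+ M' :=
  AddMonoidHom.mk' (fun m => (hj.exists_eq m).choose) fun m m' => hj.injective <| by
    rw [map_add, (hj.exists_eq _).choose_spec, (hj.exists_eq _).choose_spec,
      (hj.exists_eq _).choose_spec, smul_add]

lemma IsLeftCorner.map_proj (hj : c.IsLeftCorner j) (m : M) : j (hj.proj m) = c.incl 1 • m :=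
  (hj.exists_eq m).choose_spec

lemma IsLeftCorner.map_proj_rightGen (hj : c.IsLeftCorner j) (i : Fin c.size) (m : M) :
    j (hj.proj (c.rightGen i • m)) = c.rightGen i • m := by
  rw [hj.map_proj, ← mul_smul, c.mul_rightGen]

end LeftCorner

section Tensor

variable {A B : Type u} [Ring A] [Ring B] {c : FullCorner A B}
  {M M' : Type v} [AddCommGroup M] [Module A M] [AddCommGroup M'] [Module B M']
  {j : M' →+ M} (hj : c.IsLeftCorner j) (N : Type w) [AddCommGroup N] [Module Aᵐᵒᵖ N]

/-- The homomorphism `Ne ⊗_B eM → N ⊗_A M`. -/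
def tensorHom : Tensor B (c.rightCorner N) M' →+ Tensor A N M :=
  Tensor.lift (((Tensor.mk A N M).comp (c.rightCorner N).subtype).compl₂ j) fun n b m => by
    change Tensor.tmul A (op (c.incl b) • n.1) (j m) = Tensor.tmul A n.1 (j (b • m))
    rw [Tensor.smul_tmul, hj.map_smul]

lemma tensorHom_tmul (n : c.rightCorner N) (m : M') :
    tensorHom hj N (Tensor.tmul B n m) = Tensor.tmul A n.1 (j m) := rfl

/-- The homomorphism `N ⊗_A M → Ne ⊗_B eM` sending `n ⊗ m` to the sum of the elements
`n * left i * e ⊗ e * right i * m`. -/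
def tensorInv : Tensor A N M →+ Tensor B (c.rightCorner N) M' :=
  Tensor.lift (∑ i, (((Tensor.mk B (c.rightCorner N) M').comp
    (c.mulRight (c.leftGen i) (c.leftGen_mul i))).compl₂
      (hj.proj.comp (DistribSMul.toAddMonoidHom M (c.rightGen i))))) fun n a m => by
    simp only [AddMonoidHom.finsetSum_apply]
    change ∑ i, Tensor.tmul B (c.mulRight (c.leftGen i) (c.leftGen_mul i) (op a • n))
      (hj.proj (c.rightGen i • m)) = ∑ k, Tensor.tmul B
        (c.mulRight (c.leftGen k) (c.leftGen_mul k) n) (hj.proj (c.rightGen k • a • m))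
    have h1 : ∀ i, c.mulRight (c.leftGen i) (c.leftGen_mul i) (op a • n) =
        ∑ k, op (c.proj (c.rightGen k * a * c.leftGen i)) •
          c.mulRight (c.leftGen k) (c.leftGen_mul k) n := by
      intro i
      apply Subtype.ext
      rw [AddSubgroup.val_finsetSum]
      change op (c.leftGen i) • op a • n =
        ∑ k, op (c.incl (c.proj (c.rightGen k * a * c.leftGen i))) • op (c.leftGen k) • n
      simp only [c.incl_proj, ← mul_smul, ← op_mul]
      rw [← Finset.sum_smul, ← Finset.op_sum]
      congr 2
      rw [← one_mul (a * c.leftGen i), ← c.sum_gen, Finset.sum_mul]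
      refine Finset.sum_congr rfl fun k _ => ?_
      simp only [mul_assoc, c.leftGen_mul]
      rw [← mul_assoc (c.incl 1), c.mul_rightGen]
    have h2 : ∀ k, hj.proj (c.rightGen k • a • m) =
        ∑ i, c.proj (c.rightGen k * a * c.leftGen i) • hj.proj (c.rightGen i • m) := by
      intro k
      apply hj.injective
      rw [hj.map_proj_rightGen, map_sum]
      simp only [hj.map_smul, hj.map_proj_rightGen, c.incl_proj, ← mul_smul]
      rw [← Finset.sum_smul]
      congr 1
      have h : c.rightGen k * a = ∑ i, c.rightGen k * a * (c.leftGen i * c.rightGen i) := by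
        rw [← Finset.mul_sum, c.sum_gen, mul_one]
      refine h.trans (Finset.sum_congr rfl fun i _ => ?_)
      simp only [mul_assoc, c.mul_rightGen]
      rw [← mul_assoc (c.incl 1), c.mul_rightGen]
    simp only [h1, h2, Tensor.sum_tmul, Tensor.tmul_sum, Tensor.smul_tmul]
    exact Finset.sum_comm

lemma tensorInv_tmul (n : N) (m : M) :
    tensorInv hj N (Tensor.tmul A n m) =
      ∑ i, Tensor.tmul B (c.mulRight (c.leftGen i) (c.leftGen_mul i) n)
        (hj.proj (c.rightGen i • m)) := by
  rw [tensorInv, Tensor.lift_tmul, AddMonoidHom.finsetSum_apply, AddMonoidHom.finsetSum_apply]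
  rfl

/-- The isomorphism `Ne ⊗_B eM ≃ N ⊗_A M`. -/
def tensorEquiv : Tensor B (c.rightCorner N) M' ≃+ Tensor A N M :=
  AddMonoidHom.toAddEquiv (tensorHom hj N) (tensorInv hj N)
    (Tensor.hom_ext fun n m => by
      change tensorInv hj N (tensorHom hj N (Tensor.tmul B n m)) = Tensor.tmul B n m
      have h : ∀ i, c.mulRight (c.leftGen i) (c.leftGen_mul i) n.1 =
          op (c.proj (c.leftGen i)) • n := by
        intro i
        apply Subtype.ext
        rw [coe_smul, unop_op, c.incl_proj, mul_assoc, c.leftGen_mul, op_mul, mul_smul,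
          c.smul_of_mem n.2]
        rfl
      rw [tensorHom_tmul, tensorInv_tmul]
      simp only [h, Tensor.smul_tmul]
      rw [← Tensor.tmul_sum]
      congr 1
      apply hj.injective
      rw [map_sum]
      simp only [hj.map_smul, hj.map_proj_rightGen, c.incl_proj, ← mul_smul]
      rw [← Finset.sum_smul]
      simp only [mul_assoc, c.mul_rightGen]
      rw [← Finset.mul_sum]
      rw [c.sum_gen, mul_one, hj.smul_map])
    (Tensor.hom_ext fun n m => by
      change tensorHom hj N (tensorInv hj N (Tensor.tmul A n m)) = Tensor.tmul A n m
      rw [tensorInv_tmul, map_sum]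
      simp only [tensorHom_tmul, hj.map_proj_rightGen]
      change ∑ i, Tensor.tmul A (op (c.leftGen i) • n) (c.rightGen i • m) = _
      simp only [Tensor.smul_tmul, ← mul_smul]
      rw [← Tensor.tmul_sum, ← Finset.sum_smul, c.sum_gen, one_smul])

end Tensor

section Functor

variable {A B : Type u} [Ring A] [Ring B] (c : FullCorner A B)

/-- The functor `N ↦ Ne` from right `A`-modules to right `B`-modules. -/
def cornerFunctor : ModuleCat.{w} Aᵐᵒᵖ ⥤ ModuleCat.{w} Bᵐᵒᵖ where
  obj N := ModuleCat.of Bᵐᵒᵖ (c.rightCorner N)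
  map f := ModuleCat.ofHom (c.rightCornerMap f.hom)

instance : (cornerFunctor.{u, w} c).Additive where

instance : (cornerFunctor.{u, w} c).PreservesHomology := by
  refine ((cornerFunctor.{u, w} c).exact_tfae.out 1 2).1 fun S hS => ?_
  rw [ShortComplex.moduleCat_exact_iff] at hS ⊢
  intro x hx
  obtain ⟨y, hy⟩ := hS x.1 (congrArg Subtype.val hx)
  refine ⟨c.mulRight (c.incl 1) (c.incl_mul_one 1) y, Subtype.ext ?_⟩
  change S.f.hom (op (c.incl 1) • y) = x.1
  rw [map_smul]
  exact (congrArg (op (c.incl 1) • ·) hy).trans (c.smul_of_mem x.2)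

instance (N : ModuleCat.{u} Aᵐᵒᵖ) [Projective N] :
    Projective ((cornerFunctor.{u, u} c).obj N) :=
  have : Module.Projective Bᵐᵒᵖ (c.rightCorner N) := inferInstance
  (IsProjective.iff_projective _).1 this

/-- The projective resolution of `Ne` obtained from a projective resolution of `N`. -/
def mapResolution {N : ModuleCat.{u} Aᵐᵒᵖ} (P : ProjectiveResolution N) :
    ProjectiveResolution ((cornerFunctor.{u, u} c).obj N) where
  complex := (c.cornerFunctor.mapHomologicalComplex _).obj P.complex
  projective n := inferInstanceAs (Projective (c.cornerFunctor.obj (P.complex.X n)))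
  π := (c.cornerFunctor.mapHomologicalComplex _).map P.π ≫
    (HomologicalComplex.singleMapHomologicalComplex c.cornerFunctor
      (ComplexShape.down ℕ) 0).hom.app N

variable {c} {M M' : Type v} [AddCommGroup M] [Module A M] [AddCommGroup M'] [Module B M']
  {j : M' →+ M}

/-- The natural isomorphism `Ne ⊗_B eM ≃ N ⊗_A M`. -/
def tensorIso (hj : c.IsLeftCorner j) : tensorFunctor.{u, v, w} A M ≅ c.cornerFunctor ⋙ tensorFunctor.{u, v, w} B M' :=
  (NatIso.ofComponents (F := c.cornerFunctor ⋙ tensorFunctor.{u, v, w} B M')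
    (G := tensorFunctor.{u, v, w} A M) (fun N => AddEquiv.toAddCommGrpIso (X := AddCommGrpCat.of _)
      (Y := AddCommGrpCat.of _) (tensorEquiv hj N)) fun f =>
    congrArg AddCommGrpCat.ofHom (Tensor.hom_ext
      (f := (tensorHom hj _).comp (Tensor.map M' (c.rightCornerMap f.hom)))
      (g := (Tensor.map M f.hom).comp (tensorHom hj _)) fun _ _ => rfl)).symm

/-- The isomorphism of `Tor(N, M)` over `A` with `Tor(Ne, eM)` over `B = eAe`. -/
theorem nonempty_tor_addEquiv (hj : c.IsLeftCorner j) {N N' : Type u} [AddCommGroup N] [Module Aᵐᵒᵖ N] [AddCommGroup N']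
    [Module Bᵐᵒᵖ N'] {k : N' →+ N} (hk : c.IsRightCorner k) (n : ℕ) :
    Nonempty (Tor A n N M ≃+ Tor B n N' M') := by
  let P := projectiveResolution (ModuleCat.of Aᵐᵒᵖ N)
  let e₁ := P.isoLeftDerivedObj (tensorFunctor.{u, v, u} A M) n
  let e₂ := (HomologicalComplex.homologyFunctor _ _ n).mapIso
    ((NatIso.mapHomologicalComplex (tensorIso hj) (ComplexShape.down ℕ)).app P.complex)
  let e₃ := (c.mapResolution P).isoLeftDerivedObj (tensorFunctor.{u, v, u} B M') n
  let e₄ := ((tensorFunctor.{u, v, u} B M').leftDerived n).mapIso hk.linearEquiv.toModuleIso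
  exact ⟨(e₁ ≪≫ e₂ ≪≫ e₃.symm ≪≫ e₄.symm).addCommGroupIsoToAddEquiv⟩

end Functor

end FullCorner

lemma TwoSidedIdeal.exists_sum_eq_of_mem_span_singleton {R : Type*} [Ring R] {e x : R}
    (hx : x ∈ TwoSidedIdeal.span {e}) :
    ∃ (k : ℕ) (a b : Fin k → R), ∑ i, a i * e * b i = x := by
  rw [TwoSidedIdeal.mem_span_iff_mem_addSubgroup_closure] at hx
  induction hx using AddSubgroup.closure_induction with
  | mem x hx =>
    obtain ⟨_, ⟨a, -, _, rfl, rfl⟩, b, -, rfl⟩ := hx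
    exact ⟨1, fun _ => a, fun _ => b, by simp⟩
  | zero => exact ⟨0, 0, 0, by simp⟩
  | add x y _ _ hx hy =>
    obtain ⟨k, a, b, rfl⟩ := hx
    obtain ⟨l, a', b', rfl⟩ := hy
    exact ⟨k + l, Fin.append a a', Fin.append b b', by simp [Fin.sum_univ_add]⟩
  | neg x _ hx =>
    obtain ⟨k, a, b, rfl⟩ := hx
    exact ⟨k, -a, b, by simp⟩

namespace AmpleGroupoid

open MulOpposite

variable {𝒢 : AmpleGroupoid.{u}}

lemma ZRing.ind_congr {U V : Set 𝒢.Arr} (hU : 𝒢.IsBisection U) (hV : 𝒢.IsBisection V)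
    (h : U = V) : ZRing.ind hU = ZRing.ind hV := by
  subst h
  rfl

/-! #### Sets of arrows -/

lemma setMul_one_left (K : Set 𝒢.Obj) (U : Set 𝒢.Arr) :
    𝒢.setMul (𝒢.one '' K) U = 𝒢.rng ⁻¹' K ∩ U := by
  ext g
  constructor
  · rintro ⟨_, ⟨x, hx, rfl⟩, b, hb, h, rfl⟩
    obtain rfl : x = 𝒢.rng b := (𝒢.src_one x).symm.trans h
    rw [𝒢.one_mul]
    exact ⟨hx, hb⟩
  · rintro ⟨hg, hU⟩
    exact ⟨_, ⟨_, hg, rfl⟩, g, hU, 𝒢.src_one _, 𝒢.one_mul g⟩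

lemma setMul_one_right (U : Set 𝒢.Arr) (K : Set 𝒢.Obj) :
    𝒢.setMul U (𝒢.one '' K) = U ∩ 𝒢.src ⁻¹' K := by
  ext g
  constructor
  · rintro ⟨a, ha, _, ⟨x, hx, rfl⟩, h, rfl⟩
    obtain rfl : 𝒢.src a = x := h.trans (𝒢.rng_one x)
    rw [𝒢.mul_one]
    exact ⟨ha, hx⟩
  · rintro ⟨hU, hg⟩
    exact ⟨g, hU, _, ⟨_, hg, rfl⟩, (𝒢.rng_one _).symm, 𝒢.mul_one g⟩

lemma setLeft_one (K L : Set 𝒢.Obj) : 𝒢.setLeft (𝒢.one '' K) L = K ∩ L := by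
  ext x
  constructor
  · rintro ⟨_, ⟨⟨y, hy, rfl⟩, hL⟩, rfl⟩
    rw [Set.mem_preimage, 𝒢.src_one] at hL
    rw [𝒢.rng_one]
    exact ⟨hy, hL⟩
  · rintro ⟨hK, hL⟩
    exact ⟨_, ⟨⟨x, hK, rfl⟩, by rwa [Set.mem_preimage, 𝒢.src_one]⟩, 𝒢.rng_one x⟩

lemma setRight_one (K L : Set 𝒢.Obj) : 𝒢.setRight L (𝒢.one '' K) = K ∩ L := by
  ext x
  constructor
  · rintro ⟨_, ⟨⟨y, hy, rfl⟩, hL⟩, rfl⟩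
    rw [Set.mem_preimage, 𝒢.rng_one] at hL
    rw [𝒢.src_one]
    exact ⟨hy, hL⟩
  · rintro ⟨hK, hL⟩
    exact ⟨_, ⟨⟨x, hK, rfl⟩, by rwa [Set.mem_preimage, 𝒢.rng_one]⟩, 𝒢.src_one x⟩

lemma setMul_image_inv {U : Set 𝒢.Arr} (hU : 𝒢.IsBisection U) :
    𝒢.setMul U (𝒢.inv '' U) = 𝒢.one '' (𝒢.rng '' U) := by
  ext g
  constructor
  · rintro ⟨a, ha, _, ⟨b, hb, rfl⟩, h, rfl⟩
    obtain rfl : a = b := hU.src_inj ha hb (h.trans (𝒢.rng_inv b))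
    rw [𝒢.mul_inv]
    exact ⟨_, ⟨a, ha, rfl⟩, rfl⟩
  · rintro ⟨_, ⟨a, ha, rfl⟩, rfl⟩
    exact ⟨a, ha, _, ⟨a, ha, rfl⟩, _, 𝒢.mul_inv a⟩

lemma IsBisection.image_inv {U : Set 𝒢.Arr} (hU : 𝒢.IsBisection U) :
    𝒢.IsBisection (𝒢.inv '' U) where
  isOpen := by
    rw [Set.image_eq_preimage_of_inverse 𝒢.inv_inv 𝒢.inv_inv]
    exact hU.isOpen.preimage 𝒢.continuous_inv
  isCompact := hU.isCompact.image 𝒢.continuous_inv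
  src_inj := by
    rintro _ ⟨a, ha, rfl⟩ _ ⟨b, hb, rfl⟩ e
    rw [𝒢.src_inv, 𝒢.src_inv] at e
    rw [hU.rng_inj ha hb e]
  rng_inj := by
    rintro _ ⟨a, ha, rfl⟩ _ ⟨b, hb, rfl⟩ e
    rw [𝒢.rng_inv, 𝒢.rng_inv] at e
    rw [hU.src_inj ha hb e]

/-! #### The full corner given by a full compact open set of units -/

lemma charUnit_sup (K L : CompactOpens 𝒢.Obj) :
    charUnit (K ⊔ L) = charUnit K + charUnit L - charUnit K * charUnit L := by
  apply ZRing.ext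
  rw [charUnit, charUnit, charUnit, ZRing.ind_mul_ind]
  change (𝒢.one '' (K ∪ L : Set 𝒢.Obj)).indicator 1 = (𝒢.one '' K).indicator 1 +
    (𝒢.one '' L).indicator 1 - (𝒢.setMul (𝒢.one '' K) (𝒢.one '' L)).indicator 1
  have h : 𝒢.setMul (𝒢.one '' (K : Set 𝒢.Obj)) (𝒢.one '' L) = 𝒢.one '' K ∩ 𝒢.one '' L := by
    rw [setMul_one_left]
    ext g
    refine and_congr_left ?_
    rintro ⟨x, hx, rfl⟩
    rw [Set.mem_preimage, 𝒢.rng_one, (Function.LeftInverse.injective 𝒢.rng_one).mem_set_image]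
  rw [h, Set.image_union, eq_sub_iff_add_eq, Set.indicator_union_add_inter]

variable {Y : CompactOpens 𝒢.Obj}

lemma incl_injective : Function.Injective (incl (𝒢 := 𝒢) Y) := fun f h e => by
  apply ZRing.ext
  ext g
  have := congrFun (congrArg Subtype.val e) (inclArr g)
  change extendZero f.1 (inclArr g) = extendZero h.1 (inclArr g) at this
  rwa [extendZero, extendZero, inclArr_injective.extend_apply,
    inclArr_injective.extend_apply] at this

lemma image_inclArr_preimage (U : Set 𝒢.Arr) :
    inclArr '' (inclArr (Y := Y) ⁻¹' U) = 𝒢.reductionArr Y ∩ U :=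
  Subtype.image_preimage_coe _ _

lemma IsBisection.preimage_inclArr {U : Set 𝒢.Arr} (hU : 𝒢.IsBisection U) :
    (𝒢.reduction Y).IsBisection (inclArr ⁻¹' U) where
  isOpen := hU.isOpen.preimage continuous_subtype_val
  isCompact := by
    refine Subtype.isCompact_iff.2 ((image_inclArr_preimage U).symm ▸ ?_)
    rw [Set.inter_comm]
    exact hU.isCompact.inter_right ((Y.isCompact.isClosed.preimage 𝒢.continuous_rng).inter
      (Y.isCompact.isClosed.preimage 𝒢.continuous_src))
  src_inj a ha b hb e := inclArr_injective (hU.src_inj ha hb (congrArg Subtype.val e))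
  rng_inj a ha b hb e := inclArr_injective (hU.rng_inj ha hb (congrArg Subtype.val e))

lemma exists_incl_eq (f : 𝒢.ZRing) : ∃ f', incl Y f' = charUnit Y * f * charUnit Y := by
  induction f using ZRing.induction with
  | zero => exact ⟨0, by rw [map_zero, mul_zero, zero_mul]⟩
  | add f h hf hh =>
    obtain ⟨f', hf⟩ := hf
    obtain ⟨h', hh⟩ := hh
    exact ⟨f' + h', by rw [map_add, mul_add, add_mul, hf, hh]⟩
  | neg f hf =>
    obtain ⟨f', hf⟩ := hf
    exact ⟨-f', by rw [map_neg, mul_neg, neg_mul, hf]⟩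
  | ind U hU =>
    refine ⟨ZRing.ind hU.preimage_inclArr, ?_⟩
    rw [incl_ind, charUnit, ZRing.ind_mul_ind, ZRing.ind_mul_ind]
    apply ZRing.ind_congr
    rw [image_inclArr_preimage, setMul_one_right, setMul_one_left]
    ext g
    exact ⟨fun h => ⟨⟨h.1.1, h.2⟩, h.1.2⟩, fun h => ⟨⟨h.1.1, h.2⟩, h.1.2⟩⟩

lemma charUnit_image_rng_mem_span [CompactSpace 𝒢.Obj] {V : Set 𝒢.Arr} (hV : 𝒢.IsBisection V)
    (hVY : V ⊆ 𝒢.src ⁻¹' Y) {K : CompactOpens 𝒢.Obj} (hK : (K : Set 𝒢.Obj) = 𝒢.rng '' V) :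
    charUnit K ∈ TwoSidedIdeal.span {charUnit Y} := by
  have h : charUnit K = ZRing.ind hV * charUnit Y * ZRing.ind hV.image_inv := by
    rw [charUnit, charUnit, ZRing.ind_mul_ind, ZRing.ind_mul_ind]
    apply ZRing.ind_congr
    rw [setMul_one_right, Set.inter_eq_left.2 hVY, setMul_image_inv hV, hK]
  rw [h]
  exact TwoSidedIdeal.mul_mem_right _ _ _
    (TwoSidedIdeal.mul_mem_left _ _ _ (TwoSidedIdeal.subset_span rfl))

lemma IsFull.span_charUnit [CompactSpace 𝒢.Obj] (hY : 𝒢.IsFull Y) :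
    (1 : 𝒢.ZRing) ∈ TwoSidedIdeal.span {charUnit Y} := by
  have key : ∃ K : CompactOpens 𝒢.Obj, Set.univ ⊆ (K : Set 𝒢.Obj) ∧
      charUnit K ∈ TwoSidedIdeal.span {charUnit Y} := by
    refine isCompact_univ.induction_on (p := fun s => ∃ K : CompactOpens 𝒢.Obj,
      s ⊆ (K : Set 𝒢.Obj) ∧ charUnit K ∈ TwoSidedIdeal.span {charUnit Y}) ?_ ?_ ?_ ?_
    · have h : 𝒢.IsBisection (∅ : Set 𝒢.Arr) :=
        ⟨isOpen_empty, isCompact_empty, Set.injOn_empty _, Set.injOn_empty _⟩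
      exact ⟨⊥, Set.empty_subset _, charUnit_image_rng_mem_span h (Set.empty_subset _)
        (Set.image_empty _).symm⟩
    · rintro s t hst ⟨K, hK, h⟩
      exact ⟨K, hst.trans hK, h⟩
    · rintro s t ⟨K, hK, h⟩ ⟨L, hL, h'⟩
      refine ⟨K ⊔ L, Set.union_subset_union hK hL, ?_⟩
      rw [charUnit_sup]
      exact TwoSidedIdeal.sub_mem _ (TwoSidedIdeal.add_mem _ h h')
        (TwoSidedIdeal.mul_mem_left _ _ _ h')
    · rintro x -
      obtain ⟨g, hg, rfl⟩ := hY x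
      obtain ⟨V, hV, hgV, hVY⟩ := exists_bisection (Y.isOpen.preimage 𝒢.continuous_src) hg
      have ho : IsOpen (𝒢.rng '' V) := 𝒢.isLocalHomeomorph_rng.isOpenMap _ hV.isOpen
      refine ⟨𝒢.rng '' V, mem_nhdsWithin_of_mem_nhds (ho.mem_nhds ⟨g, hgV, rfl⟩),
        ⟨⟨𝒢.rng '' V, hV.isCompact.image 𝒢.continuous_rng⟩, ho⟩, subset_rfl, ?_⟩
      exact charUnit_image_rng_mem_span hV hVY rfl
  obtain ⟨K, hK, h⟩ := key
  obtain rfl : K = ⊤ := top_le_iff.1 hK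
  exact h

variable (Y) in
/-- The ring `ℤ𝒢^Y_Y` is a full corner of `ℤ𝒢`. -/
lemma IsFull.exists_fullCorner [CompactSpace 𝒢.Obj] (hY : 𝒢.IsFull Y) :
    ∃ c : FullCorner 𝒢.ZRing (𝒢.reduction Y).ZRing, ∀ f, c.incl f = incl Y f := by
  obtain ⟨k, a, b, h⟩ :=
    TwoSidedIdeal.exists_sum_eq_of_mem_span_singleton hY.span_charUnit
  choose p hp using exists_incl_eq (Y := Y)
  refine ⟨{
    incl := { incl Y with map_mul' := incl_mul }
    incl_injective := incl_injective
    proj := AddMonoidHom.mk' p fun f f' => incl_injective <| by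
      rw [map_add, hp, hp, hp, mul_add, add_mul]
    incl_proj := fun f => by
      change incl Y (p f) = incl Y 1 * f * incl Y 1
      rw [incl_one, hp]
    size := k
    left := a
    right := b
    sum_eq_one := by
      change ∑ i, a i * incl Y 1 * b i = 1
      rw [incl_one, h] }, fun _ => rfl⟩

/-! #### The trivial modules -/

/-- The characteristic function of a compact open set of units, as an element of `ℤ𝒢⁰`. -/
def TrivMod.ind {K : Set 𝒢.Obj} (hKo : IsOpen K) (hKc : IsCompact K) : 𝒢.TrivMod :=
  ⟨K.indicator 1, AddSubgroup.subset_closure ⟨K, hKo, hKc, inferInstance, rfl⟩⟩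

/-- The inclusion of the units of `𝒢^Y_Y` into those of `𝒢`. -/
def inclObj (x : (𝒢.reduction Y).Obj) : 𝒢.Obj := Subtype.val (p := fun x => x ∈ Y) x

lemma inclObj_injective : Function.Injective (inclObj (𝒢 := 𝒢) (Y := Y)) :=
  Subtype.val_injective

lemma extend_inclObj_indicator (K : Set (𝒢.reduction Y).Obj) :
    Function.extend inclObj (K.indicator (1 : (𝒢.reduction Y).Obj → ℤ)) 0 = (inclObj '' K).indicator 1 := by
  ext x
  by_cases hx : ∃ x', inclObj (𝒢 := 𝒢) (Y := Y) x' = x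
  · obtain ⟨x, rfl⟩ := hx
    rw [inclObj_injective.extend_apply]
    by_cases h : x ∈ K
    · rw [Set.indicator_of_mem h, Set.indicator_of_mem (Set.mem_image_of_mem _ h)]
      rfl
    · rw [Set.indicator_of_notMem h, Set.indicator_of_notMem]
      rwa [inclObj_injective.mem_set_image]
  · rw [Function.extend_apply' _ _ _ hx, Set.indicator_of_notMem]
    · rfl
    · rintro ⟨x', _, e⟩
      exact hx ⟨x', e⟩

lemma isOpen_image_inclObj {K : Set (𝒢.reduction Y).Obj} (hK : IsOpen K) :
    IsOpen (inclObj '' K) :=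
  Y.isOpen.isOpenMap_subtype_val K hK

lemma isCompact_image_inclObj {K : Set (𝒢.reduction Y).Obj} (hK : IsCompact K) :
    IsCompact (inclObj '' K) :=
  hK.image continuous_subtype_val

lemma image_inclObj_preimage (K : Set 𝒢.Obj) :
    inclObj '' (inclObj (Y := Y) ⁻¹' K) = (Y : Set 𝒢.Obj) ∩ K :=
  Subtype.image_preimage_coe _ _

lemma isOpen_preimage_inclObj {K : Set 𝒢.Obj} (hK : IsOpen K) :
    IsOpen (inclObj (Y := Y) ⁻¹' K) :=
  hK.preimage continuous_subtype_val

lemma isCompact_preimage_inclObj {K : Set 𝒢.Obj} (hK : IsCompact K) :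
    IsCompact (inclObj (Y := Y) ⁻¹' K) := by
  refine Subtype.isCompact_iff.2 ((image_inclObj_preimage K).symm ▸ ?_)
  exact hK.inter_left Y.isCompact.isClosed

variable (Y) in
/-- The extension by zero of functions on `Y`, as a homomorphism of trivial modules. -/
def inclTriv : (𝒢.reduction Y).TrivMod →+ 𝒢.TrivMod :=
  AddMonoidHom.mk' (fun h => ⟨Function.extend inclObj h.1 0, by
    induction h using TrivMod.induction with
    | ind K hKo hKc =>
      rw [extend_inclObj_indicator]
      exact (TrivMod.ind (isOpen_image_inclObj hKo) (isCompact_image_inclObj hKc)).2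
    | zero =>
      change Function.extend inclObj (0 : (𝒢.reduction Y).Obj → ℤ) 0 ∈ _
      rw [Function.extend_zero]
      exact AddSubgroup.zero_mem _
    | add f h hf hh =>
      have := Function.extend_add (inclObj (𝒢 := 𝒢) (Y := Y)) f.1 h.1 0 0
      rw [add_zero] at this
      change Function.extend inclObj (f.1 + h.1) 0 ∈ _
      rw [this]
      exact AddSubgroup.add_mem _ hf hh
    | neg f hf =>
      have := Function.extend_neg (inclObj (𝒢 := 𝒢) (Y := Y)) f.1 0
      rw [neg_zero] at this
      change Function.extend inclObj (-f.1) 0 ∈ _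
      rw [this]
      exact AddSubgroup.neg_mem _ hf⟩) fun f h => TrivMod.ext <| by
    have := Function.extend_add (inclObj (𝒢 := 𝒢) (Y := Y)) f.1 h.1 0 0
    rwa [add_zero] at this

lemma inclTriv_ind {K : Set (𝒢.reduction Y).Obj} (hKo : IsOpen K) (hKc : IsCompact K) :
    inclTriv Y (TrivMod.ind hKo hKc) =
      TrivMod.ind (isOpen_image_inclObj hKo) (isCompact_image_inclObj hKc) :=
  TrivMod.ext (extend_inclObj_indicator K)

lemma inclTriv_injective : Function.Injective (inclTriv (𝒢 := 𝒢) Y) := fun f h e => by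
  apply TrivMod.ext
  ext x
  have := congrFun (congrArg Subtype.val e) (inclObj x)
  change Function.extend inclObj f.1 0 (inclObj x) = Function.extend inclObj h.1 0 (inclObj x)
    at this
  rwa [inclObj_injective.extend_apply, inclObj_injective.extend_apply] at this

lemma TrivMod.ind_smul_ind {U : Set 𝒢.Arr} (hU : 𝒢.IsBisection U) {K : Set 𝒢.Obj}
    (hKo : IsOpen K) (hKc : IsCompact K) : ZRing.ind hU • TrivMod.ind hKo hKc =
      TrivMod.ind (isOpen_setLeft hU.isOpen hKo) (isCompact_setLeft hU.isCompact hKc) :=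
  TrivMod.ext (leftAct_indicator hU)

lemma TrivMod.op_ind_smul_ind {U : Set 𝒢.Arr} (hU : 𝒢.IsBisection U) {K : Set 𝒢.Obj}
    (hKo : IsOpen K) (hKc : IsCompact K) : op (ZRing.ind hU) • TrivMod.ind hKo hKc =
      TrivMod.ind (isOpen_setRight hKo hU.isOpen) (isCompact_setRight hKc hU.isCompact) :=
  TrivMod.ext (rightAct_indicator hU)

lemma TrivMod.ind_congr {K L : Set 𝒢.Obj} (hKo : IsOpen K) (hKc : IsCompact K) (hLo : IsOpen L)
    (hLc : IsCompact L) (h : K = L) : TrivMod.ind hKo hKc = TrivMod.ind hLo hLc := by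
  subst h
  rfl

lemma image_setLeft (U : Set (𝒢.reduction Y).Arr) (K : Set (𝒢.reduction Y).Obj) :
    inclObj '' (𝒢.reduction Y).setLeft U K = 𝒢.setLeft (inclArr '' U) (inclObj '' K) := by
  ext x
  constructor
  · rintro ⟨_, ⟨a, ⟨ha, hK⟩, rfl⟩, rfl⟩
    exact ⟨_, ⟨⟨a, ha, rfl⟩, _, hK, rfl⟩, rfl⟩
  · rintro ⟨_, ⟨⟨a, ha, rfl⟩, y, hK, e⟩, rfl⟩
    obtain rfl : y = (𝒢.reduction Y).src a := inclObj_injective e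
    exact ⟨_, ⟨a, ⟨ha, hK⟩, rfl⟩, rfl⟩

lemma image_setRight (U : Set (𝒢.reduction Y).Arr) (K : Set (𝒢.reduction Y).Obj) :
    inclObj '' (𝒢.reduction Y).setRight K U = 𝒢.setRight (inclObj '' K) (inclArr '' U) := by
  ext x
  constructor
  · rintro ⟨_, ⟨a, ⟨ha, hK⟩, rfl⟩, rfl⟩
    exact ⟨_, ⟨⟨a, ha, rfl⟩, _, hK, rfl⟩, rfl⟩
  · rintro ⟨_, ⟨⟨a, ha, rfl⟩, y, hK, e⟩, rfl⟩
    obtain rfl : y = (𝒢.reduction Y).rng a := inclObj_injective e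
    exact ⟨_, ⟨a, ⟨ha, hK⟩, rfl⟩, rfl⟩

variable [CompactSpace 𝒢.Obj]

lemma inclTriv_smul (f : (𝒢.reduction Y).ZRing) (h : (𝒢.reduction Y).TrivMod) :
    inclTriv Y (f • h) = incl Y f • inclTriv Y h := by
  induction f using ZRing.induction with
  | zero => simp only [map_zero, zero_smul]
  | add f f' hf hf' => simp only [map_add, add_smul, hf, hf']
  | neg f hf => simp only [map_neg, neg_smul, hf]
  | ind U hU =>
  induction h using TrivMod.induction with
  | zero => simp only [map_zero, smul_zero]
  | add f f' hf hf' => simp only [map_add, smul_add, hf, hf']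
  | neg f hf => simp only [map_neg, smul_neg, hf]
  | ind K hKo hKc =>
    change inclTriv Y (ZRing.ind hU • TrivMod.ind hKo hKc) =
      incl Y (ZRing.ind hU) • inclTriv Y (TrivMod.ind hKo hKc)
    rw [TrivMod.ind_smul_ind, inclTriv_ind, inclTriv_ind, incl_ind, TrivMod.ind_smul_ind]
    exact TrivMod.ind_congr _ _ _ _ (image_setLeft U K)

lemma inclTriv_op_smul (f : (𝒢.reduction Y).ZRing) (h : (𝒢.reduction Y).TrivMod) :
    inclTriv Y (op f • h) = op (incl Y f) • inclTriv Y h := by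
  induction f using ZRing.induction with
  | zero => simp only [map_zero, op_zero, zero_smul]
  | add f f' hf hf' => simp only [map_add, MulOpposite.op_add, add_smul, hf, hf']
  | neg f hf => simp only [map_neg, MulOpposite.op_neg, neg_smul, hf]
  | ind U hU =>
  induction h using TrivMod.induction with
  | zero => simp only [map_zero, smul_zero]
  | add f f' hf hf' => simp only [map_add, smul_add, hf, hf']
  | neg f hf => simp only [map_neg, smul_neg, hf]
  | ind K hKo hKc =>
    change inclTriv Y (op (ZRing.ind hU) • TrivMod.ind hKo hKc) =
      op (incl Y (ZRing.ind hU)) • inclTriv Y (TrivMod.ind hKo hKc)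
    rw [TrivMod.op_ind_smul_ind, inclTriv_ind, inclTriv_ind, incl_ind, TrivMod.op_ind_smul_ind]
    exact TrivMod.ind_congr _ _ _ _ (image_setRight U K)

lemma exists_inclTriv_eq (h : 𝒢.TrivMod) : ∃ h', inclTriv Y h' = charUnit Y • h ∧
    inclTriv Y h' = op (charUnit Y) • h := by
  induction h using TrivMod.induction with
  | zero => exact ⟨0, by rw [map_zero, smul_zero], by rw [map_zero, smul_zero]⟩
  | add f h hf hh =>
    obtain ⟨f', hf, hf'⟩ := hf
    obtain ⟨h', hh, hh'⟩ := hh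
    exact ⟨f' + h', by rw [map_add, smul_add, hf, hh], by rw [map_add, smul_add, hf', hh']⟩
  | neg f hf =>
    obtain ⟨f', hf, hf'⟩ := hf
    exact ⟨-f', by rw [map_neg, smul_neg, hf], by rw [map_neg, smul_neg, hf']⟩
  | ind K hKo hKc =>
    refine ⟨TrivMod.ind (isOpen_preimage_inclObj hKo) (isCompact_preimage_inclObj hKc),
      ?_, ?_⟩
    · change _ = charUnit Y • TrivMod.ind hKo hKc
      rw [inclTriv_ind, charUnit, TrivMod.ind_smul_ind]
      apply TrivMod.ind_congr
      rw [setLeft_one]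
      exact image_inclObj_preimage K
    · change _ = op (charUnit Y) • TrivMod.ind hKo hKc
      rw [inclTriv_ind, charUnit, TrivMod.op_ind_smul_ind]
      apply TrivMod.ind_congr
      rw [setRight_one]
      exact image_inclObj_preimage K

section Corner

variable {c : FullCorner 𝒢.ZRing (𝒢.reduction Y).ZRing}

lemma isLeftCorner_inclTriv (hc : ∀ f, c.incl f = incl Y f) : c.IsLeftCorner (inclTriv Y) where
  injective := inclTriv_injective
  map_smul f h := by rw [hc, inclTriv_smul]
  exists_eq h := by
    obtain ⟨h', e, -⟩ := exists_inclTriv_eq (Y := Y) h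
    exact ⟨h', by rw [hc, incl_one, e]⟩

lemma isRightCorner_inclTriv (hc : ∀ f, c.incl f = incl Y f) : c.IsRightCorner (inclTriv Y) where
  injective := inclTriv_injective
  map_smul f h := by rw [hc, inclTriv_op_smul]
  exists_eq h := by
    obtain ⟨h', -, e⟩ := exists_inclTriv_eq (Y := Y) h
    exact ⟨h', by rw [hc, incl_one, e]⟩

lemma isLeftCorner_subtype (hc : ∀ f, c.incl f = incl Y f) (M : Type v) [AddCommGroup M]
    [Module 𝒢.ZRing M] : c.IsLeftCorner (corner Y M).subtype where
  injective := Subtype.val_injective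
  map_smul f m := by
    rw [hc]
    rfl
  exists_eq m := ⟨⟨charUnit Y • m, m, rfl⟩, by
    rw [hc, incl_one]
    rfl⟩

end Corner

end AmpleGroupoid

end

theorem theoremt (𝒢 : AmpleGroupoid.{u}) [CompactSpace 𝒢.Obj] (Y : CompactOpens 𝒢.Obj)
    (hY : 𝒢.IsFull Y) :
    (∀ (M : Type v) [AddCommGroup M] [Module 𝒢.ZRing M] (n : ℕ),
      Nonempty (𝒢.homology n M ≃+ (𝒢.reduction Y).homology n (AmpleGroupoid.corner Y M))) ∧
    ∀ n : ℕ, Nonempty (𝒢.integralHomology n ≃+ (𝒢.reduction Y).integralHomology n) := by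
  obtain ⟨c, hc⟩ := hY.exists_fullCorner Y
  exact ⟨fun M _ _ n => FullCorner.nonempty_tor_addEquiv
      (AmpleGroupoid.isLeftCorner_subtype hc M) (AmpleGroupoid.isRightCorner_inclTriv hc) n,
    FullCorner.nonempty_tor_addEquiv
      (AmpleGroupoid.isLeftCorner_inclTriv hc) (AmpleGroupoid.isRightCorner_inclTriv hc)⟩
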